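/- Fix integers $d,G,I\ge 1$, $K\ge 0$, $N_L\ge 2$, let $\Omega=(0,1]^d$ and let $\mu$ be Lebesgue measure on $\Omega$. **Trees.** A tree $T$ of depth $K$ is obtained from the root $\Omega$ by dividing every node $A=\prod_i(a_i,b_i]$ at levels $0,\dots,K-1$: one chooses a dimension $D(A)=j\in\{1,\dots,d\}$ and a location $L(A)=l/N_L$, $1\le l\le N_L-1$, and cuts $A$ at $x_j=a_j+\frac{l}{N_L}(b_j-a_j)$ into a lower (left) child $A_l$ and an upper (right) child $A_r$, again half-open boxes. $\mathcal N(T)$ denotes the nodes at levels $<K$, $\mathcal L(T)$ the leaves (level $K$), and $\mathcal T^K$ the finite set of all such trees. **Model.** Let $\eta\ge 0$ and let $f:[0,\infty)\to[0,\infty)$ be non-decreasing with $f(0)=0$. The decisions at the nodes have (independent) prior probabilities $P(D(A)=j)=\lambda_j(A)>0$, $\sum_j\lambda_j(A)=1$, and $P(L(A)=l/N_L)\propto\exp\{-\eta\, n(A) f(|l/N_L-1/2|)\}$, $l=1,\dots,N_L-1$, where $n(A)$ is the number of observations (of all groups) in $A$; $P(T)$ is the product of these probabilities over $A\in\mathcal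 N(T)$. Given $T$, latent states $V(A)\in\{1,\dots,I\}$, $A\in\mathcal N(T)$, form a Markov process from the root to the leaves with an arbitrary initial law and arbitrary transition matrices at the nodes. Given $T$ and the states, the vectors $(\theta_1(A),\dots,\theta_G(A))$ are independent over $A\in\mathcal N(T)$, and each has, depending on $T$, $A$ and $V(A)$, one of three types of priors: (A) the $\theta_g(A)$ are independent with beta laws; (B) $\theta_1(A)=\dots=\theta_G(A)$ with a common beta law; (C) $\theta_1(A)=\dots=\theta_G(A)=c$ for a constant $c\in(0,1)$. The sampling measure $Q_g$ satisfies $Q_g(A_l\mid A)=\theta_g(A)=1-Q_g(A_r\mid A)$ on $\mathcal N(T)$ and is uniform on each leaf; group $g$ is an i.i.d. sample from $Q_g$, independently over $g$. Let $P(\mathbf x\mid T)$ be the likelihood with all states and all $\theta_g(A)$ integrated out, and let the marginal posterior of the tree be $P(T\mid\mathbf x)\propto P(T)P(\mathbf x\mid T)$. **Truth.** The data $\mathbf x_n$ consist in fact of $G$ independent i.i.d. samples, the $g$th one of size $n_g$ from a probability measure $P_g$, where $n=n_1+\dots+n_G$. Assume that $n_g/n\to\zeta_g>0$ as $n\to\infty$,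 that $P_g\ll\mu$, and that $dP_g/d\mu>0$ $\mu$-a.e. on $\Omega$, for every $g$. Call a state $i$ feasible at $A\in\mathcal N(T)$ if $(P_1(A_l\mid A),\dots,P_G(A_l\mid A))$ lies in the support of the prior of $(\theta_1(A),\dots,\theta_G(A))$ given $T$ and $V(A)=i$. Assume that for every $T\in\mathcal T^K$ the prior probability given $T$ that $V(A)$ is feasible at $A$ for all $A\in\mathcal N(T)$ simultaneously is positive. **Theorem.** Let $P_g|_T(B)=\sum_{A\in\mathcal L(T)}P_g(A)\frac{\mu(B\cap A)}{\mu(A)}$, $$B_g(T)=\sum_{A\in\mathcal N(T)}P_g(A)\, f\!\left(\left|\frac{\mu(A_l)}{\mu(A)}-\frac12\right|\right),\qquad \mathcal T^K_M=\operatorname*{arg\,min}_{T\in\mathcal T^K}\ \sum_{g=1}^G\zeta_g\left\{\mathrm{KL}(P_g\,\|\,P_g|_T)+\eta\, B_g(T)\right\},$$ where the criterion takes values in $[0,\infty]$. Then, as $n\to\infty$, $P(T\in\mathcal T^K_M\mid\mathbf x_n)\to 1$ in probability. -/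

import Mathlib

open MeasureTheory ProbabilityTheory Filter Topology
open scoped ENNReal BigOperators

noncomputable section

namespace PolyaTree

/-! ### Nodes, dyadic partition trees of depth `K`, and their boxes -/

/-- Positions of the non-terminal nodes of a tree whose leaves are all at level `K`: a level
`k < K` and the sequence of left (`true`) / right (`false`) turns leading from the root to it. -/
abbrev Node (K : ℕ) : Type := Σ k : Fin K, (Fin k → Bool)

/-- Positions of the leaves (level `K`). -/
abbrev Leaf (K : ℕ) : Type := Fin K → Bool

/-- A splitting decision `(D, L)`: the dimension to divide and the index of the grid point.
The index `l : Fin (NL - 1)` stands for the relative location `(l + 1) / NL`, so that the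
locations are exactly `1 / NL, …, (NL - 1) / NL`. -/
abbrev Decision (d NL : ℕ) : Type := Fin d × Fin (NL - 1)

/-- The collection of partition trees with maximum depth `K`: one splitting decision for every
non-terminal node. -/
abbrev Tree (d K NL : ℕ) : Type := Node K → Decision d NL

/-- The relative location of a grid point. -/
def loc {NL : ℕ} (l : Fin (NL - 1)) : ℝ := ((l : ℝ) + 1) / (NL : ℝ)

theorem loc_pos {NL : ℕ} (l : Fin (NL - 1)) : 0 < loc l := by
  have h : (0 : ℝ) < NL := by
    have := l.2
    exact_mod_cast (by omega : 0 < NL)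
  unfold loc
  positivity

theorem loc_lt_one {NL : ℕ} (l : Fin (NL - 1)) : loc l < 1 := by
  have hl := l.2
  have h : (0 : ℝ) < NL := by exact_mod_cast (by omega : 0 < NL)
  have h2 : ((l : ℝ) + 1) < NL := by exact_mod_cast (by omega : (l : ℕ) + 1 < NL)
  unfold loc
  rwa [div_lt_one h]

/-- The sample space `(0, 1]^d`, as a half-open box. -/
def Omega (d : ℕ) : BoxIntegral.Box (Fin d) where
  lower := fun _ => 0
  upper := fun _ => 1
  lower_lt_upper := fun _ => zero_lt_one

/-- Lebesgue measure on `(0, 1]^d`. -/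
def leb (d : ℕ) : Measure (Fin d → ℝ) :=
  volume.restrict (Omega d : Set (Fin d → ℝ))

/-- The coordinate `a_j + loc * (b_j - a_j)` at which a box is cut. -/
def cutPoint {d NL : ℕ} (A : BoxIntegral.Box (Fin d)) (J : Decision d NL) : ℝ :=
  A.lower J.1 + loc J.2 * (A.upper J.1 - A.lower J.1)

theorem lower_lt_cutPoint {d NL : ℕ} (A : BoxIntegral.Box (Fin d)) (J : Decision d NL) :
    A.lower J.1 < cutPoint A J := by
  have := mul_pos (loc_pos J.2) (sub_pos.2 (A.lower_lt_upper J.1))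
  unfold cutPoint
  linarith

theorem cutPoint_lt_upper {d NL : ℕ} (A : BoxIntegral.Box (Fin d)) (J : Decision d NL) :
    cutPoint A J < A.upper J.1 := by
  have := mul_lt_mul_of_pos_right (loc_lt_one J.2) (sub_pos.2 (A.lower_lt_upper J.1))
  unfold cutPoint
  linarith

/-- The left child `A_l` of the box `A` under the decision `J`. -/
def childL {d NL : ℕ} (A : BoxIntegral.Box (Fin d)) (J : Decision d NL) :
    BoxIntegral.Box (Fin d) where
  lower := A.lower
  upper := Function.update A.upper J.1 (cutPoint A J)
  lower_lt_upper := fun i => by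
    rcases eq_or_ne i J.1 with rfl | h
    · simpa using lower_lt_cutPoint A J
    · simp [Function.update_of_ne h]

/-- The right child `A_r` of the box `A` under the decision `J`. -/
def childR {d NL : ℕ} (A : BoxIntegral.Box (Fin d)) (J : Decision d NL) :
    BoxIntegral.Box (Fin d) where
  lower := Function.update A.lower J.1 (cutPoint A J)
  upper := A.upper
  lower_lt_upper := fun i => by
    rcases eq_or_ne i J.1 with rfl | h
    · simpa using cutPoint_lt_upper A J
    · simp [Function.update_of_ne h]

/-- The box of the tree `T` at level `k ≤ K` and position `w`. -/
def cell {d K NL : ℕ} (T : Tree d K NL) :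
    (k : ℕ) → k ≤ K → (Fin k → Bool) → BoxIntegral.Box (Fin d)
  | 0, _, _ => Omega d
  | k + 1, h, w =>
    if w (Fin.last k) then
      childL (cell T k (Nat.le_of_succ_le h) (Fin.init w)) (T ⟨⟨k, h⟩, Fin.init w⟩)
    else
      childR (cell T k (Nat.le_of_succ_le h) (Fin.init w)) (T ⟨⟨k, h⟩, Fin.init w⟩)

/-- The box of a non-terminal node. -/
def nodeBox {d K NL : ℕ} (T : Tree d K NL) (a : Node K) : BoxIntegral.Box (Fin d) :=
  cell T a.1 a.1.2.le a.2

/-- The box of a leaf. -/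
def leafBox {d K NL : ℕ} (T : Tree d K NL) (w : Leaf K) : BoxIntegral.Box (Fin d) :=
  cell T K le_rfl w

/-- The non-terminal node at level `k` on the path to the leaf `w`. -/
def pathNode {K : ℕ} (w : Leaf K) (k : Fin K) : Node K :=
  ⟨k, Fin.take k k.2.le w⟩

/-! ### The model -/

/-- The three types of priors for `(θ_1(A), …, θ_G(A))`: (A) independent beta variables,
(B) one beta variable common to all groups, (C) one constant in `(0, 1)` common to all groups. -/
def IsNodePrior {G : ℕ} (m : Measure (Fin G → ℝ)) : Prop :=
  (∃ α β : Fin G → ℝ, (∀ g, 0 < α g) ∧ (∀ g, 0 < β g) ∧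
      m = Measure.pi fun g => betaMeasure (α g) (β g)) ∨
  (∃ α β : ℝ, 0 < α ∧ 0 < β ∧ m = (betaMeasure α β).map fun t _ => t) ∨
  (∃ c : ℝ, 0 < c ∧ c < 1 ∧ m = Measure.dirac fun _ => c)

/-- The hyperparameters of the hidden Markov Pólya tree model with `G` groups, `I` latent states,
sample space `(0, 1]^d`, depth `K` and grid size `NL`. -/
structure Model (d G I K NL : ℕ) where
  /-- `lam a A j` is the prior probability `λ_j(A)` that the box `A`, at position `a`, is divided
  along dimension `j`. -/
  lam : Node K → BoxIntegral.Box (Fin d) → Fin d → ℝ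
  lam_pos : ∀ a A j, 0 < lam a A j
  lam_sum : ∀ a A, ∑ j, lam a A j = 1
  /-- The strength of the penalty on unbalanced splits in the prior of the locations. -/
  eta : ℝ
  eta_nonneg : 0 ≤ eta
  /-- The penalty function on `[0, ∞)`. -/
  f : ℝ → ℝ
  f_mono : MonotoneOn f (Set.Ici 0)
  f_zero : f 0 = 0
  /-- Given the tree, the law of the latent state of the root. -/
  init : Tree d K NL → Fin I → ℝ
  init_nonneg : ∀ T i, 0 ≤ init T i
  init_sum : ∀ T, ∑ i, init T i = 1
  /-- Given the tree, `trans T a i i'` is the probability `ξ_{i,i'}(A)` that the node at `a` has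
  state `i'` when its parent has state `i` (not used at the root). -/
  trans : Tree d K NL → Node K → Fin I → Fin I → ℝ
  trans_nonneg : ∀ T a i i', 0 ≤ trans T a i i'
  trans_sum : ∀ T a i, ∑ i', trans T a i i' = 1
  /-- The prior of `(θ_1(A), …, θ_G(A))` given the tree and the state `i` of the node. -/
  thetaPrior : Tree d K NL → Node K → Fin I → Measure (Fin G → ℝ)
  isNodePrior : ∀ T a i, IsNodePrior (thetaPrior T a i)

/-- Observations of `G` groups, with `m g` observations in group `g`. -/
abbrev Data (d : ℕ) {G : ℕ} (m : Fin G → ℕ) : Type := (g : Fin G) → Fin (m g) → (Fin d → ℝ)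

/-- The number `n(A)` of observations, of all groups together, in the set `A`. -/
def count {d G : ℕ} {m : Fin G → ℕ} (x : Data d m) (A : Set (Fin d → ℝ)) : ℝ :=
  ∑ g, ∑ i, A.indicator (fun _ => (1 : ℝ)) (x g i)

namespace Model

variable {d G I K NL : ℕ} (M : Model d G I K NL)

/-- The unnormalised prior weight `exp (-η n(A) f(|l / NL - 1 / 2|))` of a location. -/
def locWeight {m : Fin G → ℕ} (x : Data d m) (A : BoxIntegral.Box (Fin d))
    (l : Fin (NL - 1)) : ℝ :=
  Real.exp (-(M.eta * count x (A : Set (Fin d → ℝ)) * M.f |loc l - 1 / 2|))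

/-- The prior probability `β_l(A)` of a location. -/
def locPrior {m : Fin G → ℕ} (x : Data d m) (A : BoxIntegral.Box (Fin d))
    (l : Fin (NL - 1)) : ℝ :=
  M.locWeight x A l / ∑ l', M.locWeight x A l'

/-- The prior probability `P(T)` of a tree. The prior of the locations depends on the data
through the counts `n(A)`. -/
def treePrior {m : Fin G → ℕ} (x : Data d m) (T : Tree d K NL) : ℝ :=
  ∏ a : Node K, M.lam a (nodeBox T a) (T a).1 * M.locPrior x (nodeBox T a) (T a).2

/-- The factor of the node `a` in the probability of the state configuration `v`. -/
def stateFactor (T : Tree d K NL) (v : Node K → Fin I) : Node K → ℝ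
  | ⟨⟨0, h⟩, w⟩ => M.init T (v ⟨⟨0, h⟩, w⟩)
  | ⟨⟨k + 1, h⟩, w⟩ =>
    M.trans T ⟨⟨k + 1, h⟩, w⟩ (v ⟨⟨k, Nat.lt_of_succ_lt h⟩, Fin.init w⟩) (v ⟨⟨k + 1, h⟩, w⟩)

/-- The prior probability, given the tree, that the latent states are `v`. -/
def stateProb (T : Tree d K NL) (v : Node K → Fin I) : ℝ :=
  ∏ a : Node K, M.stateFactor T v a

/-- The prior law of all the parameters `θ_g(A)`, given the tree and the latent states. -/
def thetaLaw (T : Tree d K NL) (v : Node K → Fin I) : Measure (Node K → Fin G → ℝ) :=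
  Measure.pi fun a => M.thetaPrior T a (v a)

end Model

/-- The probability of a leaf under the conditional probabilities `θ(A) = Q(A_l | A)`. -/
def leafProb {K : ℕ} (θ : Node K → ℝ) (w : Leaf K) : ℝ :=
  ∏ k : Fin K, if w k then θ (pathNode w k) else 1 - θ (pathNode w k)

/-- The density, with respect to Lebesgue measure on `(0, 1]^d`, of the sampling measure `Q` given
by a tree and conditional probabilities; `Q` is uniform within each leaf. -/
def samplingDensity {d K NL : ℕ} (T : Tree d K NL) (θ : Node K → ℝ) (z : Fin d → ℝ) : ℝ :=
  ∑ w : Leaf K, (leafBox T w : Set (Fin d → ℝ)).indicator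
    (fun _ => leafProb θ w / (leb d).real (leafBox T w)) z

namespace Model

variable {d G I K NL : ℕ} (M : Model d G I K NL)

/-- The marginal likelihood `P(x | T)`: all latent states and all parameters are integrated out. -/
def marginalLik {m : Fin G → ℕ} (x : Data d m) (T : Tree d K NL) : ℝ :=
  ∑ v : Node K → Fin I, M.stateProb T v *
    ∫ θ, (∏ g, ∏ i, samplingDensity T (fun a => θ a g) (x g i)) ∂(M.thetaLaw T v)

open Classical in
/-- The marginal posterior probability `P(T ∈ S | x)`. -/
def posterior {m : Fin G → ℕ} (x : Data d m) (S : Set (Tree d K NL)) : ℝ :=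
  (∑ T ∈ Finset.univ.filter (· ∈ S), M.treePrior x T * M.marginalLik x T) /
    ∑ T, M.treePrior x T * M.marginalLik x T

/-- The feasible states `τ(A | T)` of a node: the true conditional probabilities
`(P_1(A_l | A), …, P_G(A_l | A))` lie in the support of the prior under that state. -/
def feasible (P : Fin G → Measure (Fin d → ℝ)) (T : Tree d K NL) (a : Node K) : Set (Fin I) :=
  {i | (fun g => (P g).real (childL (nodeBox T a) (T a)) / (P g).real (nodeBox T a)) ∈
    (M.thetaPrior T a i).support}

open Classical in
/-- Given the tree, the prior probability that the states of all nodes are feasible. -/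
def feasibleProb (P : Fin G → Measure (Fin d → ℝ)) (T : Tree d K NL) : ℝ :=
  ∑ v ∈ Finset.univ.filter (fun v : Node K → Fin I => ∀ a, v a ∈ M.feasible P T a),
    M.stateProb T v

end Model

/-! ### The limiting criterion -/

/-- The tree-based approximation `H|_T (B) = ∑_{leaves A} H(A) μ(B ∩ A) / μ(A)`. -/
def treeApprox {d K NL : ℕ} (H : Measure (Fin d → ℝ)) (T : Tree d K NL) :
    Measure (Fin d → ℝ) :=
  ∑ w : Leaf K, (H (leafBox T w) / leb d (leafBox T w)) •
    (leb d).restrict (leafBox T w : Set (Fin d → ℝ))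

namespace Model

variable {d G I K NL : ℕ} (M : Model d G I K NL)

/-- The penalty `B(T) = ∑_{non-terminal A} H(A) f(|μ(A_l) / μ(A) - 1 / 2|)` under `H`. -/
def imbalance (H : Measure (Fin d → ℝ)) (T : Tree d K NL) : ℝ :=
  ∑ a : Node K, H.real (nodeBox T a) *
    M.f |(leb d).real (childL (nodeBox T a) (T a)) / (leb d).real (nodeBox T a) - 1 / 2|

/-- The criterion `∑_g ζ_g {KL(P_g ‖ P_g|_T) + η B_g(T)}`, with values in `[0, ∞]`. -/
def criterion (P : Fin G → Measure (Fin d → ℝ)) (ζ : Fin G → ℝ) (T : Tree d K NL) : ℝ≥0∞ :=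
  ∑ g, ENNReal.ofReal (ζ g) *
    (InformationTheory.klDiv (P g) (treeApprox (P g) T) +
      ENNReal.ofReal (M.eta * M.imbalance (P g) T))

/-- The set of trees that minimise the criterion. -/
def minimisers (P : Fin G → Measure (Fin d → ℝ)) (ζ : Fin G → ℝ) : Set (Tree d K NL) :=
  {T | ∀ T', M.criterion P ζ T ≤ M.criterion P ζ T'}

end Model

end PolyaTree

end

noncomputable section

namespace PolyaTree

/-! ### Cells -/

section Cells

variable {d K NL : ℕ}

/-! There are finitely many trees, so it suffices to find the exponential rate of each posterior
weight: along almost every sample path, `treePrior * marginalLik` equals `exp (n (r T + o(1)))`, and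
normalised weights concentrate on the trees of largest rate (`tendsto_sum_filter_div_sum`).
Randomness enters only through `ae_isTypical`, where the strong law makes all cell frequencies
converge; the rest is deterministic. Prior: the normaliser at a node is dominated by the least
penalised location. Since the node masses at each level sum to one, the normalisers add the same
constant to every tree's rate, and what distinguishes trees is `-η ∑ ζ_g B_g(T)`
(`hasRate_treePrior`). Likelihood: a Gibbs inequality bounds it, uniformly in the parameters, by its
value at the true conditional probabilities (`eventually_treeLik_le`). Conversely, a feasible state
configuration puts positive prior mass near these probabilities, where the likelihood is nearly as
large (`le_treeLik`). Hence the rate is `∑ ζ_g approxEntropy (P g) T` (`hasRate_marginalLik`).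
Criterion: `KL(P_g ‖ P_g|_T) = KL(P_g ‖ μ) - approxEntropy (P g) T` (`klDiv_treeApprox`), so the
criterion is a constant minus the rate when every `KL(P_g ‖ μ)` is finite. Otherwise it is infinite
at every tree, and all trees are minimisers. -/

theorem mem_childL_iff (A : BoxIntegral.Box (Fin d)) (J : Decision d NL) (z : Fin d → ℝ) :
    z ∈ childL A J ↔ z ∈ A ∧ z J.1 ≤ cutPoint A J := by
  simp only [BoxIntegral.Box.mem_def, childL, Set.mem_Ioc]
  constructor
  · intro h
    have hJ := h J.1
    simp only [Function.update_self] at hJ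
    refine ⟨fun i => ?_, hJ.2⟩
    rcases eq_or_ne i J.1 with rfl | hi
    · exact ⟨hJ.1, hJ.2.trans (cutPoint_lt_upper A J).le⟩
    · simpa [Function.update_of_ne hi] using h i
  · rintro ⟨h, hJ⟩ i
    rcases eq_or_ne i J.1 with rfl | hi
    · simpa using ⟨(h _).1, hJ⟩
    · simpa [Function.update_of_ne hi] using h i

theorem mem_childR_iff (A : BoxIntegral.Box (Fin d)) (J : Decision d NL) (z : Fin d → ℝ) :
    z ∈ childR A J ↔ z ∈ A ∧ cutPoint A J < z J.1 := by
  simp only [BoxIntegral.Box.mem_def, childR, Set.mem_Ioc]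
  constructor
  · intro h
    have hJ := h J.1
    simp only [Function.update_self] at hJ
    refine ⟨fun i => ?_, hJ.1⟩
    rcases eq_or_ne i J.1 with rfl | hi
    · exact ⟨(lower_lt_cutPoint A J).trans hJ.1, hJ.2⟩
    · simpa [Function.update_of_ne hi] using h i
  · rintro ⟨h, hJ⟩ i
    rcases eq_or_ne i J.1 with rfl | hi
    · simpa using ⟨hJ, (h _).2⟩
    · simpa [Function.update_of_ne hi] using h i

theorem measureReal_childL_add_childR (H : Measure (Fin d → ℝ)) [IsFiniteMeasure H]
    (A : BoxIntegral.Box (Fin d)) (J : Decision d NL) :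
    H.real (childL A J) + H.real (childR A J) = H.real A := by
  rw [← measureReal_union _ (BoxIntegral.Box.measurableSet_coe _)]
  · congr 1
    ext z
    simp only [Set.mem_union, BoxIntegral.Box.mem_coe, mem_childL_iff, mem_childR_iff]
    rcases le_or_gt (z J.1) (cutPoint A J) with h | h <;> simp [h]
  · rw [Set.disjoint_left]
    intro z h1 h2
    rw [BoxIntegral.Box.mem_coe, mem_childL_iff] at h1
    rw [BoxIntegral.Box.mem_coe, mem_childR_iff] at h2
    exact absurd h1.2 h2.2.not_ge

/-- The cells at level `k` form a partition of `(0, 1]^d`. -/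
theorem exists_mem_cell_iff (T : Tree d K NL) {z : Fin d → ℝ} (hz : z ∈ Omega d) :
    ∀ (k : ℕ) (h : k ≤ K), ∃ w₀, ∀ w, z ∈ cell T k h w ↔ w = w₀
  | 0, _ => ⟨Fin.elim0, fun w => by simp [cell, hz, Subsingleton.elim w Fin.elim0]⟩
  | k + 1, h => by
    obtain ⟨u, hu⟩ := exists_mem_cell_iff T hz k (Nat.le_of_succ_le h)
    set A := cell T k (Nat.le_of_succ_le h) u
    set J := T ⟨⟨k, h⟩, u⟩
    -- The parent must be the level-`k` cell of `z`, and the last turn is then decided by comparing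
    -- `z` with its cut point.
    have key : ∀ (w : Fin k → Bool) (b : Bool),
        z ∈ cell T (k + 1) h (Fin.snoc (α := fun _ => Bool) w b) ↔
          w = u ∧ b = decide (z J.1 ≤ cutPoint A J) := by
      intro w b
      have hw := hu w
      cases b
      · simp only [cell, Fin.snoc_last, Fin.init_snoc, Bool.false_eq_true, if_false,
          mem_childR_iff, hw]
        constructor
        · rintro ⟨rfl, h2⟩
          exact ⟨rfl, by simpa using h2⟩
        · rintro ⟨rfl, h2⟩
          exact ⟨rfl, by simpa using h2⟩
      · simp only [cell, Fin.snoc_last, Fin.init_snoc, if_true, mem_childL_iff, hw]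
        constructor
        · rintro ⟨rfl, h2⟩
          exact ⟨rfl, by simpa using h2⟩
        · rintro ⟨rfl, h2⟩
          exact ⟨rfl, by simpa using h2⟩
    refine ⟨Fin.snoc (α := fun _ => Bool) u (decide (z J.1 ≤ cutPoint A J)), fun w => ?_⟩
    rw [← Fin.snoc_init_self (α := fun _ => Bool) w, key, Fin.snoc_inj]

theorem cell_subset_Omega (T : Tree d K NL) :
    ∀ (k : ℕ) (h : k ≤ K) (w : Fin k → Bool),
      (cell T k h w : Set (Fin d → ℝ)) ⊆ (Omega d : Set (Fin d → ℝ))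
  | 0, _, _ => by simp [cell]
  | k + 1, h, w => by
    intro z hz
    apply cell_subset_Omega T k (Nat.le_of_succ_le h) (Fin.init w)
    rw [BoxIntegral.Box.mem_coe, cell] at hz
    split_ifs at hz
    · exact ((mem_childL_iff _ _ _).1 hz).1
    · exact ((mem_childR_iff _ _ _).1 hz).1

theorem sum_indicator_cell (T : Tree d K NL) {z : Fin d → ℝ}
    {k : ℕ} (h : k ≤ K) {w₀ : Fin k → Bool} (hw : ∀ w, z ∈ cell T k h w ↔ w = w₀)
    (c : (Fin k → Bool) → ℝ) :
    ∑ w, (cell T k h w : Set (Fin d → ℝ)).indicator (fun _ => c w) z = c w₀ := by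
  rw [Finset.sum_eq_single w₀]
  · exact Set.indicator_of_mem ((hw w₀).2 rfl) _
  · intro w _ hne
    exact Set.indicator_of_notMem (fun hz => hne ((hw w).1 hz)) _
  · simp

theorem sum_indicator_cell_one (T : Tree d K NL) {z : Fin d → ℝ} (hz : z ∈ Omega d)
    {k : ℕ} (h : k ≤ K) :
    ∑ w, (cell T k h w : Set (Fin d → ℝ)).indicator (fun _ => (1 : ℝ)) z = 1 := by
  obtain ⟨w₀, hw⟩ := exists_mem_cell_iff T hz k h
  exact sum_indicator_cell T h hw fun _ => 1

instance isProbabilityMeasure_leb : IsProbabilityMeasure (leb d) := by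
  constructor
  have : (Omega d : Set (Fin d → ℝ)) = Set.univ.pi fun _ => Set.Ioc (0 : ℝ) 1 := by
    rw [BoxIntegral.Box.coe_eq_pi]
    rfl
  rw [leb, Measure.restrict_apply_univ, this, Real.volume_pi_Ioc]
  simp

instance sigmaFinite_leb : SigmaFinite (leb d) := inferInstance

theorem ae_mem_Omega {H : Measure (Fin d → ℝ)} (hH : H ≪ leb d) : ∀ᵐ z ∂H, z ∈ Omega d :=
  hH.ae_le (ae_restrict_mem (BoxIntegral.Box.measurableSet_coe (Omega d)))

theorem sum_measureReal_cell {H : Measure (Fin d → ℝ)} [IsProbabilityMeasure H]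
    (hH : H ≪ leb d) (T : Tree d K NL) {k : ℕ} (h : k ≤ K) :
    ∑ w, H.real (cell T k h w) = 1 := by
  have h1 : ∀ w, H.real (cell T k h w) =
      ∫ z, (cell T k h w : Set (Fin d → ℝ)).indicator (fun _ => (1 : ℝ)) z ∂H := fun w => by
    rw [integral_indicator_const _ (BoxIntegral.Box.measurableSet_coe _)]
    simp
  simp_rw [h1]
  rw [← integral_finsetSum]
  · rw [integral_congr_ae (g := fun _ => (1 : ℝ))]
    · simp
    · filter_upwards [ae_mem_Omega hH] with z hz
      exact sum_indicator_cell_one T hz h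
  · intro w _
    exact (integrable_const _).indicator (BoxIntegral.Box.measurableSet_coe _)

/-! ### Lebesgue measure of boxes and positivity of cell probabilities -/

theorem volume_real_box (A : BoxIntegral.Box (Fin d)) :
    (volume : Measure (Fin d → ℝ)).real A = ∏ i, (A.upper i - A.lower i) := by
  rw [BoxIntegral.Box.coe_eq_pi]
  exact Real.volume_pi_Ioc_toReal A.lower_le_upper

theorem volume_real_box_pos (A : BoxIntegral.Box (Fin d)) :
    0 < (volume : Measure (Fin d → ℝ)).real A := by
  rw [volume_real_box]
  exact Finset.prod_pos fun i _ => sub_pos.2 (A.lower_lt_upper i)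

theorem leb_real_of_subset {A : BoxIntegral.Box (Fin d)}
    (hA : (A : Set (Fin d → ℝ)) ⊆ (Omega d : Set (Fin d → ℝ))) :
    (leb d).real A = (volume : Measure (Fin d → ℝ)).real A := by
  rw [leb, measureReal_restrict_apply (BoxIntegral.Box.measurableSet_coe _),
    Set.inter_eq_left.2 hA]

theorem leb_real_cell_pos (T : Tree d K NL) {k : ℕ} (h : k ≤ K) (w : Fin k → Bool) :
    0 < (leb d).real (cell T k h w) := by
  rw [leb_real_of_subset (cell_subset_Omega T k h w)]
  exact volume_real_box_pos _

theorem volume_real_childL (A : BoxIntegral.Box (Fin d)) (J : Decision d NL) :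
    (volume : Measure (Fin d → ℝ)).real (childL A J) =
      loc J.2 * (volume : Measure (Fin d → ℝ)).real A := by
  rw [volume_real_box, volume_real_box, ← Finset.mul_prod_erase _ _ (Finset.mem_univ J.1),
    ← Finset.mul_prod_erase _ _ (Finset.mem_univ J.1), ← mul_assoc]
  congr 1
  · simp [childL, cutPoint]
  · refine Finset.prod_congr rfl fun i hi => ?_
    simp [childL, Function.update_of_ne (Finset.ne_of_mem_erase hi)]

/-- Links the penalty in the criterion, expressed by volumes, to the penalty in the prior, expressed
by grid locations. -/
theorem leb_real_childL_div (T : Tree d K NL) (a : Node K) :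
    (leb d).real (childL (nodeBox T a) (T a)) / (leb d).real (nodeBox T a) = loc (T a).2 := by
  have hA : (nodeBox T a : Set (Fin d → ℝ)) ⊆ (Omega d : Set (Fin d → ℝ)) :=
    cell_subset_Omega T a.1 a.1.2.le a.2
  rw [leb_real_of_subset hA, leb_real_of_subset, volume_real_childL]
  · exact mul_div_cancel_right₀ _ (volume_real_box_pos _).ne'
  · intro z hz
    exact hA ((mem_childL_iff _ _ _).1 hz).1

/-- The form in which positivity of the densities is used: every cell then has positive probability,
so conditional probabilities and logarithms of leaf masses are genuine. -/
theorem leb_absolutelyContinuous {H : Measure (Fin d → ℝ)} [IsFiniteMeasure H]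
    (hac : H ≪ leb d) (hpos : ∀ᵐ z ∂leb d, 0 < H.rnDeriv (leb d) z) : leb d ≪ H := by
  have h := Measure.withDensity_rnDeriv_eq H (leb d) hac
  rw [← h]
  exact withDensity_absolutelyContinuous' (Measure.measurable_rnDeriv _ _).aemeasurable
    (hpos.mono fun z hz => hz.ne')

theorem measureReal_cell_pos {H : Measure (Fin d → ℝ)} [IsFiniteMeasure H] (hH : leb d ≪ H)
    (T : Tree d K NL) {k : ℕ} (h : k ≤ K) (w : Fin k → Bool) : 0 < H.real (cell T k h w) := by
  refine measureReal_nonneg.lt_of_ne' fun h0 => ?_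
  rw [measureReal_eq_zero_iff] at h0
  have := leb_real_cell_pos T h w
  rw [measureReal_def, hH h0] at this
  simp at this

end Cells

/-! ### Probabilities of cells under conditional probabilities of left children -/

section CellProb

variable {d K NL : ℕ}

/-- The probability of a cell at level `k` under the conditional probabilities `θ`. -/
def cellProb (θ : Node K → ℝ) : (k : ℕ) → k ≤ K → (Fin k → Bool) → ℝ
  | 0, _, _ => 1
  | k + 1, h, w =>
    cellProb θ k (Nat.le_of_succ_le h) (Fin.init w) *
      if w (Fin.last k) then θ ⟨⟨k, h⟩, Fin.init w⟩ else 1 - θ ⟨⟨k, h⟩, Fin.init w⟩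

/-- Connects the recursion, which allows induction on the level, with the product over a path that
defines `leafProb`. -/
theorem cellProb_eq_prod (θ : Node K → ℝ) :
    ∀ (k : ℕ) (h : k ≤ K) (w : Fin k → Bool), cellProb θ k h w =
      ∏ j : Fin k, if w j then θ ⟨⟨j, j.2.trans_le h⟩, Fin.take j j.2.le w⟩
        else 1 - θ ⟨⟨j, j.2.trans_le h⟩, Fin.take j j.2.le w⟩
  | 0, _, _ => by simp [cellProb]
  | k + 1, h, w => by
    rw [cellProb, cellProb_eq_prod θ k (Nat.le_of_succ_le h), Fin.prod_univ_castSucc]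
    rfl

theorem leafProb_eq_cellProb (θ : Node K → ℝ) (w : Leaf K) :
    leafProb θ w = cellProb θ K le_rfl w :=
  (cellProb_eq_prod θ K le_rfl w).symm

/-- The two children of a cell contribute the factors `θ` and `1 - θ`, so the total is the same at
all levels; no sign condition is needed. -/
theorem sum_cellProb (θ : Node K → ℝ) :
    ∀ (k : ℕ) (h : k ≤ K), ∑ w, cellProb θ k h w = 1
  | 0, _ => by simp [cellProb]
  | k + 1, h => by
    rw [← (Fin.snocEquiv fun _ => Bool).sum_comp, Fintype.sum_prod_type, Fintype.sum_bool,
      ← Finset.sum_add_distrib, ← sum_cellProb θ k (Nat.le_of_succ_le h)]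
    refine Finset.sum_congr rfl fun w _ => ?_
    have hi : ∀ b, Fin.init (Fin.snocEquiv (fun _ => Bool) (b, w)) = w :=
      fun b => Fin.init_snoc (α := fun _ => Bool) b w
    simp only [cellProb, hi, Fin.snocEquiv_apply, Fin.snoc_last, if_true, Bool.false_eq_true,
      if_false]
    ring

theorem sum_leafProb (θ : Node K → ℝ) : ∑ w, leafProb θ w = 1 := by
  simp_rw [leafProb_eq_cellProb]
  exact sum_cellProb θ K le_rfl

theorem leafProb_nonneg {θ : Node K → ℝ} (hθ : ∀ a, θ a ∈ Set.Icc (0 : ℝ) 1) (w : Leaf K) :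
    0 ≤ leafProb θ w := by
  refine Finset.prod_nonneg fun k _ => ?_
  have := hθ (pathNode w k)
  split_ifs
  · exact this.1
  · exact sub_nonneg.2 this.2

theorem continuous_leafProb (w : Leaf K) : Continuous fun θ : Node K → ℝ => leafProb θ w := by
  refine continuous_finsetProd _ fun k _ => ?_
  split_ifs <;> fun_prop

/-- The conditional probabilities of left children under `H`. -/
def condProb (H : Measure (Fin d → ℝ)) (T : Tree d K NL) (a : Node K) : ℝ :=
  H.real (childL (nodeBox T a) (T a)) / H.real (nodeBox T a)

/-- The product of conditional probabilities telescopes along the path, all parents having positive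
mass. -/
theorem cellProb_condProb {H : Measure (Fin d → ℝ)} [IsProbabilityMeasure H]
    (hac : H ≪ leb d) (hH : leb d ≪ H) (T : Tree d K NL) :
    ∀ (k : ℕ) (h : k ≤ K) (w : Fin k → Bool),
      cellProb (condProb H T) k h w = H.real (cell T k h w)
  | 0, h, w => by
    rw [cellProb, ← sum_measureReal_cell hac T h, Fintype.sum_subsingleton _ w]
  | k + 1, h, w => by
    rw [cellProb, cellProb_condProb hac hH T k (Nat.le_of_succ_le h), cell]
    have hpos := measureReal_cell_pos hH T (Nat.le_of_succ_le h) (Fin.init w)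
    have hadd := measureReal_childL_add_childR H (cell T k (Nat.le_of_succ_le h) (Fin.init w))
      (T ⟨⟨k, h⟩, Fin.init w⟩)
    simp only [condProb, nodeBox]
    split_ifs
    · field_simp
    · rw [mul_sub, mul_div_cancel₀ _ hpos.ne']
      linarith

theorem leafProb_condProb {H : Measure (Fin d → ℝ)} [IsProbabilityMeasure H]
    (hac : H ≪ leb d) (hH : leb d ≪ H) (T : Tree d K NL) (w : Leaf K) :
    leafProb (condProb H T) w = H.real (leafBox T w) := by
  rw [leafProb_eq_cellProb, cellProb_condProb hac hH, leafBox]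

end CellProb

/-! ### Exponential rates of sequences -/

section Rate

/-- The sequence `u` is eventually positive and `u n = exp (n (r + o(1)))`. -/
def HasRate (u : ℕ → ℝ) (r : ℝ) : Prop :=
  (∀ᶠ n in atTop, 0 < u n) ∧ Tendsto (fun n : ℕ => Real.log (u n) / n) atTop (𝓝 r)

variable {u v : ℕ → ℝ} {r s : ℝ}

theorem HasRate.const {c : ℝ} (hc : 0 < c) : HasRate (fun _ => c) 0 :=
  ⟨Eventually.of_forall fun _ => hc, tendsto_const_div_atTop_nhds_zero_nat _⟩

theorem HasRate.exp (h : Tendsto (fun n : ℕ => u n / n) atTop (𝓝 r)) :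
    HasRate (fun n => Real.exp (u n)) r :=
  ⟨Eventually.of_forall fun _ => Real.exp_pos _, by simpa only [Real.log_exp] using h⟩

theorem HasRate.mul (hu : HasRate u r) (hv : HasRate v s) :
    HasRate (fun n => u n * v n) (r + s) := by
  refine ⟨(hu.1.and hv.1).mono fun n h => mul_pos h.1 h.2, (hu.2.add hv.2).congr' ?_⟩
  filter_upwards [hu.1, hv.1] with n h1 h2
  rw [Real.log_mul h1.ne' h2.ne', add_div]

theorem HasRate.inv (hu : HasRate u r) : HasRate (fun n => (u n)⁻¹) (-r) := by
  refine ⟨hu.1.mono fun n h => inv_pos.2 h, hu.2.neg.congr fun n => ?_⟩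
  rw [Real.log_inv, neg_div]

theorem HasRate.div (hu : HasRate u r) (hv : HasRate v s) :
    HasRate (fun n => u n / v n) (r - s) := by
  simpa only [div_eq_mul_inv, sub_eq_add_neg] using hu.mul hv.inv

theorem HasRate.prod {ι : Type*} (t : Finset ι) {u : ι → ℕ → ℝ} {r : ι → ℝ}
    (h : ∀ i, HasRate (u i) (r i)) : HasRate (fun n => ∏ i ∈ t, u i n) (∑ i ∈ t, r i) := by
  classical
  induction t using Finset.induction_on with
  | empty => simpa using HasRate.const one_pos
  | insert i t hi ih => simpa only [Finset.prod_insert hi, Finset.sum_insert hi] using (h i).mul ih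

theorem HasRate.squeeze {w : ℕ → ℝ} (hu : HasRate u r) (hw : HasRate w r)
    (huv : ∀ᶠ n in atTop, u n ≤ v n) (hvw : ∀ᶠ n in atTop, v n ≤ w n) : HasRate v r := by
  have hpos : ∀ᶠ n in atTop, 0 < v n := by
    filter_upwards [hu.1, huv] with n h1 h2 using h1.trans_le h2
  refine ⟨hpos, tendsto_of_tendsto_of_tendsto_of_le_of_le' hu.2 hw.2 ?_ ?_⟩
  · filter_upwards [hu.1, huv] with n h1 h2
    exact div_le_div_of_nonneg_right (Real.log_le_log h1 h2) (Nat.cast_nonneg n)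
  · filter_upwards [hpos, hvw] with n h1 h2
    exact div_le_div_of_nonneg_right (Real.log_le_log h1 h2) (Nat.cast_nonneg n)

/-- The constants may depend on `ε`, because constants have rate zero. This matters for the
likelihood, where `c` contains the prior mass of a neighbourhood that shrinks with `ε`. -/
theorem HasRate.of_approx (hu : HasRate u r)
    (h : ∀ ε > 0, ∃ c C : ℝ, 0 < c ∧ 0 < C ∧
      ∀ᶠ n : ℕ in atTop, c * u n * Real.exp (-(ε * n)) ≤ v n ∧ v n ≤ C * u n * Real.exp (ε * n)) :
    HasRate v r := by
  have hlin : ∀ a : ℝ, Tendsto (fun n : ℕ => a * n / n) atTop (𝓝 a) := fun a => by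
    refine tendsto_const_nhds.congr' ?_
    filter_upwards [eventually_gt_atTop 0] with n hn
    rw [mul_div_cancel_right₀]
    exact_mod_cast hn.ne'
  have key : ∀ ε > 0, (∀ᶠ n in atTop, 0 < v n) ∧
      ∀ᶠ n : ℕ in atTop, Real.log (v n) / n ∈ Set.Ioo (r - 2 * ε) (r + 2 * ε) := by
    intro ε hε
    obtain ⟨c, C, hc, hC, h⟩ := h ε hε
    have h1 := ((HasRate.const hc).mul hu).mul (HasRate.exp (hlin (-ε)))
    have h2 := ((HasRate.const hC).mul hu).mul (HasRate.exp (hlin ε))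
    simp only [neg_mul] at h1
    have hpos : ∀ᶠ n in atTop, 0 < v n := by
      filter_upwards [h1.1, h] with n h1 h2 using h1.trans_le h2.1
    refine ⟨hpos, ?_⟩
    filter_upwards [h1.1, h, hpos, h1.2.eventually_const_lt (u := r - 2 * ε) (by linarith),
      h2.2.eventually_lt_const (u := r + 2 * ε) (by linarith)] with n g1 g2 g3 g4 g5
    exact ⟨g4.trans_le (div_le_div_of_nonneg_right (Real.log_le_log g1 g2.1) (Nat.cast_nonneg n)),
      (div_le_div_of_nonneg_right (Real.log_le_log g3 g2.2) (Nat.cast_nonneg n)).trans_lt g5⟩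
  refine ⟨(key 1 one_pos).1, Metric.tendsto_nhds.2 fun ε hε => ?_⟩
  filter_upwards [(key (ε / 2) (half_pos hε)).2] with n hn
  rw [Real.dist_eq, abs_sub_lt_iff]
  constructor <;> linarith [hn.1, hn.2]

theorem HasRate.tendsto_div (hu : HasRate u r) (hv : HasRate v s) (h : r < s) :
    Tendsto (fun n => u n / v n) atTop (𝓝 0) := by
  have hd := hu.div hv
  have h1 : Tendsto (fun n : ℕ => Real.log (u n / v n) / n * n) atTop atBot :=
    hd.2.neg_mul_atTop (sub_neg.2 h) tendsto_natCast_atTop_atTop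
  refine (Real.tendsto_exp_atBot.comp h1).congr' ?_
  filter_upwards [hd.1, eventually_gt_atTop 0] with n h2 hn
  have : (n : ℝ) ≠ 0 := by exact_mod_cast hn.ne'
  rw [Function.comp_apply, div_mul_cancel₀ _ this, Real.exp_log h2]

/-- Normalised weights concentrate on a set which contains an index of larger exponential rate for
every index outside. -/
theorem tendsto_sum_filter_div_sum {ι : Type*} [Fintype ι] [Nonempty ι] {u : ι → ℕ → ℝ}
    {r : ι → ℝ} (hu : ∀ i, HasRate (u i) (r i)) (hnn : ∀ i n, 0 ≤ u i n) (p : ι → Prop)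
    [DecidablePred p] (hp : ∀ i, ¬p i → ∃ j, r i < r j) :
    Tendsto (fun n => (∑ i ∈ Finset.univ.filter p, u i n) / ∑ i, u i n) atTop (𝓝 1) := by
  have hzero : ∀ i, ¬p i → Tendsto (fun n => u i n / ∑ j, u j n) atTop (𝓝 0) := by
    intro i hi
    obtain ⟨j, hj⟩ := hp i hi
    -- Keeping only the term `j` of the denominator bounds the quotient by `u i n / u j n`.
    refine squeeze_zero' (Eventually.of_forall fun n =>
      div_nonneg (hnn i n) (Finset.sum_nonneg fun j _ => hnn j n)) ?_ ((hu i).tendsto_div (hu j) hj)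
    filter_upwards [(hu j).1] with n hn
    exact div_le_div_of_nonneg_left (hnn i n) hn
      (Finset.single_le_sum (fun j _ => hnn j n) (Finset.mem_univ j))
  have h1 : Tendsto (fun n => 1 - ∑ i ∈ Finset.univ.filter (fun i => ¬p i),
      u i n / ∑ j, u j n) atTop (𝓝 (1 - ∑ i ∈ Finset.univ.filter (fun i => ¬p i), 0)) :=
    tendsto_const_nhds.sub (tendsto_finsetSum _ fun i hi => hzero i (Finset.mem_filter.1 hi).2)
  rw [Finset.sum_const_zero, sub_zero] at h1
  refine h1.congr' ?_
  obtain ⟨j⟩ := ‹Nonempty ι›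
  filter_upwards [(hu j).1] with n hn
  have hsum : 0 < ∑ i, u i n :=
    hn.trans_le (Finset.single_le_sum (fun j _ => hnn j n) (Finset.mem_univ j))
  rw [← Finset.sum_div, sub_eq_iff_eq_add, ← add_div, Finset.sum_filter_add_sum_filter_not,
    div_self hsum.ne']

end Rate

/-! ### Data with convergent frequencies -/

section Typical

variable {d G I K NL : ℕ}

/-- The data `x` lie in `(0, 1]^d`, and the frequencies of all cells of trees converge to their
probabilities. -/
structure IsTypical (K NL : ℕ) (P : Fin G → Measure (Fin d → ℝ)) (ζ : Fin G → ℝ)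
    (N : ℕ → Fin G → ℕ) (x : Fin G → ℕ → (Fin d → ℝ)) : Prop where
  mem : ∀ g i, x g i ∈ Omega d
  freq : ∀ g (T : Tree d K NL) (k : ℕ) (h : k ≤ K) (w : Fin k → Bool),
    Tendsto (fun n : ℕ => (∑ i : Fin (N n g),
      (cell T k h w : Set (Fin d → ℝ)).indicator (fun _ => (1 : ℝ)) (x g i)) / n) atTop
      (𝓝 (ζ g * (P g).real (cell T k h w)))

variable {M : Model d G I K NL} {P : Fin G → Measure (Fin d → ℝ)} {ζ : Fin G → ℝ}
  {N : ℕ → Fin G → ℕ} {x : Fin G → ℕ → (Fin d → ℝ)}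

/-! ### The prior of the trees -/

theorem IsTypical.tendsto_count (hx : IsTypical K NL P ζ N x) (T : Tree d K NL) (a : Node K) :
    Tendsto (fun n : ℕ => count (m := N n) (fun g i => x g i) (nodeBox T a) / n) atTop
      (𝓝 (∑ g, ζ g * (P g).real (nodeBox T a))) := by
  simp only [count, Finset.sum_div]
  refine tendsto_finsetSum _ fun g _ => ?_
  simpa only [Finset.sum_div, nodeBox] using hx.freq g T a.1 a.1.2.le a.2

theorem locWeight_pos {m : Fin G → ℕ} (y : Data d m) (A : BoxIntegral.Box (Fin d))
    (l : Fin (NL - 1)) : 0 < M.locWeight y A l := Real.exp_pos _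

theorem count_nonneg {m : Fin G → ℕ} (y : Data d m) (A : Set (Fin d → ℝ)) : 0 ≤ count y A :=
  Finset.sum_nonneg fun _ _ => Finset.sum_nonneg fun _ _ =>
    Set.indicator_nonneg (fun _ _ => zero_le_one) _

/-- The normaliser lies between its largest term, at `l₀`, and `NL - 1` times that term. The penalty
at `l₀` need not vanish: for odd `NL` the midpoint is not on the grid. -/
theorem IsTypical.hasRate_locPrior (hx : IsTypical K NL P ζ N x) {l₀ : Fin (NL - 1)}
    (hl₀ : ∀ l : Fin (NL - 1), M.f |loc l₀ - 1 / 2| ≤ M.f |loc l - 1 / 2|) (T : Tree d K NL)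
    (a : Node K) (l : Fin (NL - 1)) :
    HasRate (fun n => M.locPrior (m := N n) (fun g i => x g i) (nodeBox T a) l)
      (-(M.eta * (∑ g, ζ g * (P g).real (nodeBox T a)) * M.f |loc l - 1 / 2|) +
        M.eta * (∑ g, ζ g * (P g).real (nodeBox T a)) * M.f |loc l₀ - 1 / 2|) := by
  have hw : ∀ l, HasRate (fun n => M.locWeight (m := N n) (fun g i => x g i) (nodeBox T a) l)
      (-(M.eta * (∑ g, ζ g * (P g).real (nodeBox T a)) * M.f |loc l - 1 / 2|)) := by
    intro l
    refine HasRate.exp ?_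
    refine (((hx.tendsto_count T a).const_mul M.eta).mul_const (M.f |loc l - 1 / 2|)).neg.congr
      fun n => ?_
    ring
  have hNL : (0 : ℝ) < (NL - 1 : ℕ) := by exact_mod_cast Fin.pos l
  have hsum : HasRate (fun n => ∑ l, M.locWeight (m := N n) (fun g i => x g i) (nodeBox T a) l)
      (-(M.eta * (∑ g, ζ g * (P g).real (nodeBox T a)) * M.f |loc l₀ - 1 / 2|)) := by
    refine (hw l₀).squeeze (w := fun n => ((NL - 1 : ℕ) : ℝ) *
      M.locWeight (m := N n) (fun g i => x g i) (nodeBox T a) l₀) ?_ ?_ ?_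
    · simpa only [zero_add] using (HasRate.const hNL).mul (hw l₀)
    · exact Eventually.of_forall fun n =>
        Finset.single_le_sum (fun l _ => (locWeight_pos _ _ l).le) (Finset.mem_univ l₀)
    · refine Eventually.of_forall fun n => ?_
      have := Finset.sum_le_card_nsmul Finset.univ
        (fun l => M.locWeight (m := N n) (fun g i => x g i) (nodeBox T a) l)
        (M.locWeight (m := N n) (fun g i => x g i) (nodeBox T a) l₀) fun l _ => by
          refine Real.exp_le_exp.2 (neg_le_neg ?_)
          exact mul_le_mul_of_nonneg_left (hl₀ l) (mul_nonneg M.eta_nonneg (count_nonneg _ _))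
      simpa using this
  have h := (hw l).div hsum
  rw [sub_neg_eq_add] at h
  exact h

/-- Each of the `K` levels is a partition of total mass one. The sum is thus the same for all trees,
which makes the normalisers irrelevant for comparing them. -/
theorem sum_measureReal_nodeBox {H : Measure (Fin d → ℝ)} [IsProbabilityMeasure H]
    (hH : H ≪ leb d) (T : Tree d K NL) : ∑ a, H.real (nodeBox T a) = K := by
  rw [Fintype.sum_sigma]
  simp only [nodeBox]
  rw [Finset.sum_congr rfl fun (k : Fin K) _ => sum_measureReal_cell hH T k.2.le]
  simp

theorem imbalance_eq (H : Measure (Fin d → ℝ)) (T : Tree d K NL) :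
    M.imbalance H T = ∑ a, H.real (nodeBox T a) * M.f |loc (T a).2 - 1 / 2| := by
  simp only [Model.imbalance, leb_real_childL_div]

/-- The factors `lam` are constants of rate zero. The last summand of the rate does not depend on
`T`. -/
theorem IsTypical.hasRate_treePrior (hx : IsTypical K NL P ζ N x)
    (hP : ∀ g, IsProbabilityMeasure (P g)) (hac : ∀ g, P g ≪ leb d) {l₀ : Fin (NL - 1)}
    (hl₀ : ∀ l : Fin (NL - 1), M.f |loc l₀ - 1 / 2| ≤ M.f |loc l - 1 / 2|) (T : Tree d K NL) :
    HasRate (fun n => M.treePrior (m := N n) (fun g i => x g i) T)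
      (-(∑ g, ζ g * (M.eta * M.imbalance (P g) T)) +
        M.eta * (∑ g, ζ g) * K * M.f |loc l₀ - 1 / 2|) := by
  have h := HasRate.prod Finset.univ fun a => (HasRate.const
    (M.lam_pos a (nodeBox T a) (T a).1)).mul (hx.hasRate_locPrior hl₀ T a (T a).2)
  have hK : ∀ g, (K : ℝ) = ∑ a, (P g).real (nodeBox T a) := fun g =>
    (sum_measureReal_nodeBox (hac g) T).symm
  have h1 : (∑ g, ζ g) * K = ∑ a, ∑ g, ζ g * (P g).real (nodeBox T a) := by
    rw [Finset.sum_comm, Finset.sum_mul]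
    refine Finset.sum_congr rfl fun g _ => ?_
    rw [hK g, Finset.mul_sum]
  have h2 : ∑ g, ζ g * (M.eta * M.imbalance (P g) T) =
      ∑ a, M.eta * (∑ g, ζ g * (P g).real (nodeBox T a)) * M.f |loc (T a).2 - 1 / 2| := by
    simp only [imbalance_eq, Finset.mul_sum, Finset.sum_mul]
    rw [Finset.sum_comm]
    refine Finset.sum_congr rfl fun a _ => Finset.sum_congr rfl fun g _ => ?_
    ring
  have h3 : -(∑ g, ζ g * (M.eta * M.imbalance (P g) T)) +
        M.eta * (∑ g, ζ g) * K * M.f |loc l₀ - 1 / 2| = ∑ a : Node K,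
      (0 + (-(M.eta * (∑ g, ζ g * (P g).real (nodeBox T a)) * M.f |loc (T a).2 - 1 / 2|) +
        M.eta * (∑ g, ζ g * (P g).real (nodeBox T a)) * M.f |loc l₀ - 1 / 2|)) := by
    simp only [zero_add]
    rw [Finset.sum_add_distrib, Finset.sum_neg_distrib, ← h2, ← Finset.sum_mul, ← Finset.mul_sum,
      ← h1, ← mul_assoc M.eta]
  rw [h3]
  exact h

end Typical

/-! ### The likelihood -/

section Likelihood

variable {d G I K NL : ℕ}

/-- The logarithm of the density of `H|_T` on `(0, 1]^d`. -/
def logApprox (H : Measure (Fin d → ℝ)) (T : Tree d K NL) (z : Fin d → ℝ) : ℝ :=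
  ∑ w : Leaf K, (leafBox T w : Set (Fin d → ℝ)).indicator
    (fun _ => Real.log (H.real (leafBox T w) / (leb d).real (leafBox T w))) z

/-- The Kullback-Leibler divergence of `H|_T` from the uniform distribution. -/
def approxEntropy (H : Measure (Fin d → ℝ)) (T : Tree d K NL) : ℝ :=
  ∑ w : Leaf K, H.real (leafBox T w) *
    Real.log (H.real (leafBox T w) / (leb d).real (leafBox T w))

/-- The likelihood given the tree and the conditional probabilities. -/
def treeLik {m : Fin G → ℕ} (x : Data d m) (T : Tree d K NL) (θ : Node K → Fin G → ℝ) : ℝ :=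
  ∏ g, ∏ i, samplingDensity T (fun a => θ a g) (x g i)

theorem indicator_const_eq_mul {α : Type*} (s : Set α) (c : ℝ) (z : α) :
    s.indicator (fun _ => c) z = c * s.indicator (fun _ => (1 : ℝ)) z := by
  by_cases hz : z ∈ s <;> simp [hz]

/-- A point of `(0, 1]^d` lies in a leaf, to which sums of indicators of leaves reduce. -/
theorem exists_sum_indicator_leafBox (T : Tree d K NL) {z : Fin d → ℝ} (hz : z ∈ Omega d) :
    ∃ w₀, ∀ c : Leaf K → ℝ,
      ∑ w, (leafBox T w : Set (Fin d → ℝ)).indicator (fun _ => c w) z = c w₀ := by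
  obtain ⟨w₀, hw⟩ := exists_mem_cell_iff T hz K le_rfl
  exact ⟨w₀, sum_indicator_cell T le_rfl hw⟩

theorem measureReal_leafBox_pos {H : Measure (Fin d → ℝ)} [IsFiniteMeasure H] (hH : leb d ≪ H)
    (T : Tree d K NL) (w : Leaf K) : 0 < H.real (leafBox T w) :=
  measureReal_cell_pos hH T le_rfl w

/-- Only the leaf containing `z` contributes. Outside `(0, 1]^d` the left side would be `1` and the
right side `0`. -/
theorem exp_logApprox {H : Measure (Fin d → ℝ)} [IsFiniteMeasure H] (hH : leb d ≪ H)
    (T : Tree d K NL) {z : Fin d → ℝ} (hz : z ∈ Omega d) :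
    Real.exp (logApprox H T z) = ∑ w : Leaf K, (leafBox T w : Set (Fin d → ℝ)).indicator
      (fun _ => H.real (leafBox T w) / (leb d).real (leafBox T w)) z := by
  obtain ⟨w₀, hw⟩ := exists_sum_indicator_leafBox T hz
  rw [logApprox, hw, hw]
  exact Real.exp_log (div_pos (measureReal_leafBox_pos hH T w₀) (leb_real_cell_pos T _ _))

/-- Separates the density of `H|_T` from a likelihood ratio that is constant on leaves; both
likelihood bounds need only control this ratio. -/
theorem samplingDensity_eq {H : Measure (Fin d → ℝ)} [IsFiniteMeasure H] (hH : leb d ≪ H)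
    (T : Tree d K NL) (θ : Node K → ℝ) {z : Fin d → ℝ} (hz : z ∈ Omega d) :
    samplingDensity T θ z = Real.exp (logApprox H T z) *
      ∑ w : Leaf K, (leafBox T w : Set (Fin d → ℝ)).indicator
        (fun _ => leafProb θ w / H.real (leafBox T w)) z := by
  rw [exp_logApprox hH T hz]
  obtain ⟨w₀, hw⟩ := exists_sum_indicator_leafBox T hz
  rw [samplingDensity, hw, hw, hw]
  have := measureReal_leafBox_pos hH T w₀
  field_simp

theorem samplingDensity_nonneg (T : Tree d K NL) {θ : Node K → ℝ}
    (hθ : ∀ a, θ a ∈ Set.Icc (0 : ℝ) 1) (z : Fin d → ℝ) : 0 ≤ samplingDensity T θ z :=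
  Finset.sum_nonneg fun w _ => Set.indicator_nonneg
    (fun _ _ => div_nonneg (leafProb_nonneg hθ w) measureReal_nonneg) _

theorem treeLik_nonneg {m : Fin G → ℕ} (x : Data d m) (T : Tree d K NL) {θ : Node K → Fin G → ℝ}
    (hθ : ∀ a g, θ a g ∈ Set.Icc (0 : ℝ) 1) : 0 ≤ treeLik x T θ :=
  Finset.prod_nonneg fun g _ => Finset.prod_nonneg fun _ _ =>
    samplingDensity_nonneg T (fun a => hθ a g) _

theorem measurable_samplingDensity (T : Tree d K NL) :
    Measurable fun p : (Node K → ℝ) × (Fin d → ℝ) => samplingDensity T p.1 p.2 := by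
  refine Finset.measurable_fun_sum _ fun w _ => ?_
  exact Measurable.indicator (f := fun p : (Node K → ℝ) × (Fin d → ℝ) =>
    leafProb p.1 w / (leb d).real (leafBox T w))
    (((continuous_leafProb w).measurable.comp measurable_fst).div_const _)
    (measurable_snd (BoxIntegral.Box.measurableSet_coe (leafBox T w)))

theorem measurable_treeLik {m : Fin G → ℕ} (T : Tree d K NL) :
    Measurable fun p : Data d m × (Node K → Fin G → ℝ) => treeLik p.1 T p.2 := by
  refine Finset.measurable_fun_prod _ fun g _ => Finset.measurable_fun_prod _ fun i _ => ?_
  refine (measurable_samplingDensity T).comp (f := fun p : Data d m × (Node K → Fin G → ℝ) =>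
    ((fun a => p.2 a g), p.1 g i)) ?_
  refine Measurable.prodMk (measurable_pi_lambda _ fun a => ?_) ?_
  · exact (measurable_pi_apply g).comp ((measurable_pi_apply a).comp measurable_snd)
  · exact (measurable_pi_apply i).comp ((measurable_pi_apply g).comp measurable_fst)

/-! ### Comparison with the likelihood at the true conditional probabilities -/

variable {P : Fin G → Measure (Fin d → ℝ)} {ζ : Fin G → ℝ}
  {N : ℕ → Fin G → ℕ} {x : Fin G → ℕ → (Fin d → ℝ)}

/-- The likelihood given the tree and the true conditional probabilities. -/
def trueLik (P : Fin G → Measure (Fin d → ℝ)) {m : Fin G → ℕ} (x : Data d m)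
    (T : Tree d K NL) : ℝ :=
  Real.exp (∑ g, ∑ i, logApprox (P g) T (x g i))

theorem IsTypical.hasRate_trueLik (hx : IsTypical K NL P ζ N x) (T : Tree d K NL) :
    HasRate (fun n => trueLik P (m := N n) (fun g i => x g i) T)
      (∑ g, ζ g * approxEntropy (P g) T) := by
  refine HasRate.exp ?_
  simp only [Finset.sum_div Finset.univ (fun g => ∑ i : Fin _, logApprox (P g) T (x g i))]
  refine tendsto_finsetSum _ fun g _ => ?_
  have h : ∀ n, (∑ i : Fin (N n g), logApprox (P g) T (x g i)) / n =
      ∑ w : Leaf K, (∑ i : Fin (N n g), (leafBox T w : Set (Fin d → ℝ)).indicator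
        (fun _ => (1 : ℝ)) (x g i)) / n *
          Real.log ((P g).real (leafBox T w) / (leb d).real (leafBox T w)) := by
    intro n
    simp only [logApprox]
    rw [Finset.sum_comm, Finset.sum_div]
    refine Finset.sum_congr rfl fun w _ => ?_
    rw [div_mul_eq_mul_div, Finset.sum_mul]
    congr 1
    refine Finset.sum_congr rfl fun i _ => ?_
    rw [indicator_const_eq_mul, mul_comm]
  rw [approxEntropy, Finset.mul_sum]
  refine Tendsto.congr (fun n => (h n).symm) (tendsto_finsetSum _ fun w _ => ?_)
  rw [← mul_assoc]
  exact (hx.freq g T K le_rfl w).mul_const _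

/-- Gibbs' inequality for finite samples. The likelihood ratios `ρ` sum over the data to at most `c
∑ leafProb = c`, and `ρ ≤ exp (ρ - 1)` turns this into a bound on their product. No logarithm of
`leafProb`, which may vanish, is taken. -/
theorem prod_samplingDensity_le {H : Measure (Fin d → ℝ)} [IsFiniteMeasure H] (hH : leb d ≪ H)
    (T : Tree d K NL) {m : ℕ} {z : Fin m → (Fin d → ℝ)} (hz : ∀ i, z i ∈ Omega d) {c : ℝ}
    (hc : ∀ w : Leaf K, ∑ i, (leafBox T w : Set (Fin d → ℝ)).indicator (fun _ => (1 : ℝ)) (z i) ≤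
      c * H.real (leafBox T w)) {θ : Node K → ℝ} (hθ : ∀ a, θ a ∈ Set.Icc (0 : ℝ) 1) :
    ∏ i, samplingDensity T θ (z i) ≤
      Real.exp (∑ i, logApprox H T (z i)) * Real.exp (c - m) := by
  set ρ : (Fin d → ℝ) → ℝ := fun z => ∑ w : Leaf K, (leafBox T w : Set (Fin d → ℝ)).indicator
    (fun _ => leafProb θ w / H.real (leafBox T w)) z with hρ
  have hpos : ∀ w, 0 < H.real (leafBox T w) := fun w => measureReal_leafBox_pos hH T w
  have hρ0 : ∀ z, 0 ≤ ρ z := fun z => Finset.sum_nonneg fun w _ => Set.indicator_nonneg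
    (fun _ _ => div_nonneg (leafProb_nonneg hθ w) (hpos w).le) _
  have hsum : ∑ i, ρ (z i) ≤ c := by
    simp only [hρ]
    rw [Finset.sum_comm, ← mul_one c, ← sum_leafProb θ, Finset.mul_sum]
    refine Finset.sum_le_sum fun w _ => ?_
    have h1 : ∑ i, (leafBox T w : Set (Fin d → ℝ)).indicator
        (fun _ => leafProb θ w / H.real (leafBox T w)) (z i) =
        leafProb θ w / H.real (leafBox T w) *
          ∑ i, (leafBox T w : Set (Fin d → ℝ)).indicator (fun _ => (1 : ℝ)) (z i) := by
      rw [Finset.mul_sum]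
      exact Finset.sum_congr rfl fun i _ => indicator_const_eq_mul _ _ _
    rw [h1]
    refine (mul_le_mul_of_nonneg_left (hc w)
      (div_nonneg (leafProb_nonneg hθ w) (hpos w).le)).trans_eq ?_
    have := (hpos w).ne'
    field_simp
  rw [Finset.prod_congr rfl fun i _ => samplingDensity_eq hH T θ (hz i),
    Finset.prod_mul_distrib, ← Real.exp_sum]
  refine mul_le_mul_of_nonneg_left ?_ (Real.exp_pos _).le
  calc ∏ i, ρ (z i) ≤ ∏ i, Real.exp (ρ (z i) - 1) :=
        Finset.prod_le_prod (fun i _ => hρ0 _) fun i _ => by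
          linarith [Real.add_one_le_exp (ρ (z i) - 1)]
    _ = Real.exp (∑ i, ρ (z i) - m) := by
        rw [← Real.exp_sum, Finset.sum_sub_distrib]
        simp
    _ ≤ Real.exp (c - m) := Real.exp_le_exp.2 (sub_le_sub_right hsum _)

/-- The likelihood is eventually bounded, uniformly in the parameters, by its value at the true
conditional probabilities, up to a subexponential factor. -/
theorem IsTypical.eventually_treeLik_le (hx : IsTypical K NL P ζ N x)
    (hP : ∀ g, IsProbabilityMeasure (P g)) (hH : ∀ g, leb d ≪ P g)
    (hlim : ∀ g, Tendsto (fun n : ℕ => (N n g : ℝ) / (n : ℝ)) atTop (𝓝 (ζ g)))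
    (T : Tree d K NL) {ε : ℝ} (hε : 0 < ε) :
    ∀ᶠ n : ℕ in atTop, ∀ θ : Node K → Fin G → ℝ, (∀ a g, θ a g ∈ Set.Icc (0 : ℝ) 1) →
      treeLik (m := N n) (fun g i => x g i) T θ ≤
        trueLik P (m := N n) (fun g i => x g i) T * Real.exp (ε * n) := by
  -- With `c = (ζ g + δ) n` and at least `(ζ g - δ) n` observations, each group costs an exponent of
  -- at most `2 δ n`. The `G + 1` keeps the denominator positive without assuming `G > 0`.
  set δ : ℝ := ε / (2 * (G + 1)) with hδ
  have hδ0 : 0 < δ := by positivity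
  have hδG : G * (2 * δ) ≤ ε := by
    have : (G + 1 : ℝ) * (2 * δ) = ε := by rw [hδ]; field_simp
    nlinarith
  have h1 : ∀ g, ∀ᶠ n : ℕ in atTop, (ζ g - δ) * n ≤ N n g := by
    intro g
    filter_upwards [(hlim g).eventually_const_lt (sub_lt_self (ζ g) hδ0), eventually_gt_atTop 0]
      with n h hn
    have hn : (0 : ℝ) < n := by exact_mod_cast hn
    exact ((lt_div_iff₀ hn).1 h).le
  have h2 : ∀ g (w : Leaf K), ∀ᶠ n : ℕ in atTop, ∑ i : Fin (N n g),
      (leafBox T w : Set (Fin d → ℝ)).indicator (fun _ => (1 : ℝ)) (x g i) ≤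
        (ζ g + δ) * n * (P g).real (leafBox T w) := by
    intro g w
    have hw : 0 < (P g).real (leafBox T w) := measureReal_leafBox_pos (hH g) T w
    filter_upwards [(hx.freq g T K le_rfl w).eventually_lt_const
      (u := (ζ g + δ) * (P g).real (leafBox T w))
      (mul_lt_mul_of_pos_right (lt_add_of_pos_right _ hδ0) hw), eventually_gt_atTop 0] with n h hn
    have hn : (0 : ℝ) < n := by exact_mod_cast hn
    have := ((div_lt_iff₀ hn).1 h).le
    exact this.trans_eq (by ring)
  filter_upwards [eventually_all.2 h1, eventually_all.2 fun g => eventually_all.2 (h2 g)]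
    with n h1 h2 θ hθ
  have h3 : ∀ g, ∏ i : Fin (N n g), samplingDensity T (fun a => θ a g) (x g i) ≤
      Real.exp (∑ i : Fin (N n g), logApprox (P g) T (x g i)) * Real.exp (2 * δ * n) := by
    intro g
    refine (prod_samplingDensity_le (hH g) T (fun i => hx.mem g i) (h2 g)
      (fun a => hθ a g)).trans ?_
    refine mul_le_mul_of_nonneg_left (Real.exp_le_exp.2 ?_) (Real.exp_pos _).le
    linarith [h1 g]
  refine (Finset.prod_le_prod (fun g _ => Finset.prod_nonneg fun _ _ =>
    samplingDensity_nonneg T (fun a => hθ a g) _) fun g _ => h3 g).trans ?_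
  rw [Finset.prod_mul_distrib, ← Real.exp_sum, trueLik]
  refine mul_le_mul_of_nonneg_left ?_ (Real.exp_pos _).le
  rw [← Real.exp_sum, Real.exp_le_exp, Finset.sum_const, Finset.card_univ, Fintype.card_fin,
    nsmul_eq_mul, ← mul_assoc]
  exact mul_le_mul_of_nonneg_right hδG (Nat.cast_nonneg n)

/-- Each observation loses at most a factor `exp (-ε)`, the likelihood ratio being at least that on
every leaf. -/
theorem le_treeLik (hP : ∀ g, IsProbabilityMeasure (P g)) (hH : ∀ g, leb d ≪ P g)
    {m : Fin G → ℕ} {y : Data d m} (hy : ∀ g i, y g i ∈ Omega d) (T : Tree d K NL) {ε : ℝ}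
    {θ : Node K → Fin G → ℝ} (hθ : ∀ g (w : Leaf K),
      Real.exp (-ε) * (P g).real (leafBox T w) ≤ leafProb (fun a => θ a g) w) :
    trueLik P y T * Real.exp (-(ε * (∑ g, m g : ℕ))) ≤ treeLik y T θ := by
  have h1 : ∀ g i, Real.exp (logApprox (P g) T (y g i)) * Real.exp (-ε) ≤
      samplingDensity T (fun a => θ a g) (y g i) := by
    intro g i
    rw [samplingDensity_eq (hH g) T _ (hy g i)]
    refine mul_le_mul_of_nonneg_left ?_ (Real.exp_pos _).le
    obtain ⟨w₀, hw⟩ := exists_sum_indicator_leafBox T (hy g i)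
    rw [hw, le_div_iff₀ (measureReal_leafBox_pos (hH g) T w₀)]
    exact hθ g w₀
  have h2 : trueLik P y T * Real.exp (-(ε * (∑ g, m g : ℕ))) =
      ∏ g, ∏ i, (Real.exp (logApprox (P g) T (y g i)) * Real.exp (-ε)) := by
    simp only [Finset.prod_mul_distrib, ← Real.exp_sum, trueLik]
    simp [Finset.mul_sum, mul_comm]
  rw [h2]
  exact Finset.prod_le_prod (fun g _ => Finset.prod_nonneg fun i _ => by positivity) fun g _ =>
    Finset.prod_le_prod (fun i _ => by positivity) fun i _ => h1 g i

/-! ### Prior laws -/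

theorem ae_betaMeasure_mem_Icc (α β : ℝ) : ∀ᵐ t ∂betaMeasure α β, t ∈ Set.Icc (0 : ℝ) 1 := by
  rw [ae_iff]
  have hs : MeasurableSet {t : ℝ | ¬t ∈ Set.Icc (0 : ℝ) 1} := measurableSet_Icc.compl
  rw [betaMeasure, withDensity_apply _ hs]
  refine (setLIntegral_congr_fun hs fun t ht => ?_).trans lintegral_zero
  rcases le_or_gt t 0 with h | h
  · exact betaPDF_eq_zero_of_nonpos h
  · refine betaPDF_eq_zero_of_one_le ?_
    by_contra h1
    exact ht ⟨h.le, (not_le.1 h1).le⟩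

theorem IsNodePrior.isProbabilityMeasure {m : Measure (Fin G → ℝ)} (h : IsNodePrior m) :
    IsProbabilityMeasure m := by
  rcases h with ⟨α, β, hα, hβ, rfl⟩ | ⟨α, β, hα, hβ, rfl⟩ | ⟨c, _, _, rfl⟩
  · have := fun g => isProbabilityMeasureBeta (hα g) (hβ g)
    infer_instance
  · have := isProbabilityMeasureBeta hα hβ
    exact Measure.isProbabilityMeasure_map (by fun_prop)
  · infer_instance

theorem IsNodePrior.ae_mem_Icc {m : Measure (Fin G → ℝ)} (h : IsNodePrior m) :
    ∀ᵐ θ ∂m, ∀ g, θ g ∈ Set.Icc (0 : ℝ) 1 := by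
  rcases h with ⟨α, β, hα, hβ, rfl⟩ | ⟨α, β, hα, hβ, rfl⟩ | ⟨c, hc0, hc1, rfl⟩
  · have := fun g => isProbabilityMeasureBeta (hα g) (hβ g)
    refine ae_all_iff.2 fun g => ?_
    exact (Measure.quasiMeasurePreserving_eval (fun g => betaMeasure (α g) (β g)) g).ae
      (ae_betaMeasure_mem_Icc _ _)
  · rw [ae_map_iff (by fun_prop)]
    · exact (ae_betaMeasure_mem_Icc α β).mono fun t ht _ => ht
    · exact MeasurableSet.univ_pi (t := fun _ => Set.Icc (0 : ℝ) 1) (fun _ => measurableSet_Icc)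
        |> fun h => by simpa [Set.pi, Set.ofPred_forall] using h
  · rw [ae_dirac_iff]
    · exact fun _ => ⟨hc0.le, hc1.le⟩
    · exact MeasurableSet.univ_pi (t := fun _ => Set.Icc (0 : ℝ) 1) (fun _ => measurableSet_Icc)
        |> fun h => by simpa [Set.pi, Set.ofPred_forall] using h

variable {M : Model d G I K NL}

instance isProbabilityMeasure_thetaPrior (T : Tree d K NL) (a : Node K) (i : Fin I) :
    IsProbabilityMeasure (M.thetaPrior T a i) := (M.isNodePrior T a i).isProbabilityMeasure

instance isProbabilityMeasure_thetaLaw (T : Tree d K NL) (v : Node K → Fin I) :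
    IsProbabilityMeasure (M.thetaLaw T v) := by
  unfold Model.thetaLaw
  infer_instance

theorem ae_thetaLaw_mem_Icc (T : Tree d K NL) (v : Node K → Fin I) :
    ∀ᵐ θ ∂M.thetaLaw T v, ∀ a g, θ a g ∈ Set.Icc (0 : ℝ) 1 :=
  ae_all_iff.2 fun a => (Measure.quasiMeasurePreserving_eval
    (fun a => M.thetaPrior T a (v a)) a).ae (M.isNodePrior T a (v a)).ae_mem_Icc

/-- A neighbourhood contains a product over nodes of neighbourhoods, and feasibility gives each
factor positive mass. The factors concern whole vectors over the groups, so priors with a common or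
constant parameter are covered. -/
theorem thetaLaw_pos_of_mem_nhds {T : Tree d K NL} {v : Node K → Fin I}
    (hv : ∀ a, v a ∈ M.feasible P T a) {U : Set (Node K → Fin G → ℝ)}
    (hU : U ∈ 𝓝 fun a g => condProb (P g) T a) : 0 < M.thetaLaw T v U := by
  rw [nhds_pi, Filter.mem_pi] at hU
  obtain ⟨J, -, t, ht, hJ⟩ := hU
  have hsub : Set.univ.pi t ⊆ U := (Set.pi_mono' (fun _ _ => subset_rfl) (Set.subset_univ J)).trans hJ
  refine lt_of_lt_of_le ?_ (measure_mono hsub)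
  rw [Model.thetaLaw, Measure.pi_pi, pos_iff_ne_zero, Finset.prod_ne_zero_iff]
  exact fun a _ => ((Measure.mem_support_iff_forall _).1 (hv a) _ (ht a)).ne'

theorem stateProb_nonneg (T : Tree d K NL) (v : Node K → Fin I) : 0 ≤ M.stateProb T v := by
  refine Finset.prod_nonneg fun a _ => ?_
  obtain ⟨⟨_ | k, h⟩, w⟩ := a
  · exact M.init_nonneg _ _
  · exact M.trans_nonneg _ _ _ _

/-! ### The marginal likelihood -/

theorem marginalLik_eq {m : Fin G → ℕ} (y : Data d m) (T : Tree d K NL) :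
    M.marginalLik y T = ∑ v, M.stateProb T v * ∫ θ, treeLik y T θ ∂M.thetaLaw T v := rfl

theorem integral_treeLik_nonneg {m : Fin G → ℕ} (y : Data d m) (T : Tree d K NL)
    (v : Node K → Fin I) : 0 ≤ ∫ θ, treeLik y T θ ∂M.thetaLaw T v :=
  integral_nonneg_of_ae ((ae_thetaLaw_mem_Icc T v).mono fun _ hθ => treeLik_nonneg y T hθ)

theorem marginalLik_nonneg {m : Fin G → ℕ} (y : Data d m) (T : Tree d K NL) :
    0 ≤ M.marginalLik y T :=
  Finset.sum_nonneg fun v _ => mul_nonneg (stateProb_nonneg T v) (integral_treeLik_nonneg y T v)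

/-- From above, the uniform bound is integrated against probability measures. From below, a single
feasible configuration and a neighbourhood `U` of the truth suffice. -/
theorem IsTypical.hasRate_marginalLik (hx : IsTypical K NL P ζ N x)
    (hP : ∀ g, IsProbabilityMeasure (P g)) (hac : ∀ g, P g ≪ leb d) (hH : ∀ g, leb d ≪ P g)
    (hN : ∀ n, ∑ g, N n g = n)
    (hlim : ∀ g, Tendsto (fun n : ℕ => (N n g : ℝ) / (n : ℝ)) atTop (𝓝 (ζ g)))
    (T : Tree d K NL) (hfeas : 0 < M.feasibleProb P T) :
    HasRate (fun n => M.marginalLik (m := N n) (fun g i => x g i) T)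
      (∑ g, ζ g * approxEntropy (P g) T) := by
  classical
  obtain ⟨v₀, hv₀, hpos⟩ : ∃ v : Node K → Fin I, (∀ a, v a ∈ M.feasible P T a) ∧
      0 < M.stateProb T v := by
    obtain ⟨v, hv, hpos⟩ := Finset.exists_lt_of_sum_lt (f := fun _ => (0 : ℝ))
      (by simpa [Model.feasibleProb] using hfeas)
    exact ⟨v, (Finset.mem_filter.1 hv).2, hpos⟩
  refine (hx.hasRate_trueLik T).of_approx fun ε hε => ?_
  -- Strict inequalities make `U` open; the truth belongs to it because `exp (-ε) < 1`.
  set U : Set (Node K → Fin G → ℝ) := {θ | ∀ g (w : Leaf K),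
    Real.exp (-ε) * (P g).real (leafBox T w) < leafProb (fun a => θ a g) w} with hUdef
  have hUo : IsOpen U := by
    simp only [hUdef, Set.ofPred_forall]
    refine isOpen_iInter_of_finite fun g => isOpen_iInter_of_finite fun w => ?_
    refine isOpen_lt continuous_const
      ((continuous_leafProb w).comp (g := fun θ => leafProb θ w)
        (f := fun (θ : Node K → Fin G → ℝ) a => θ a g) ?_)
    exact continuous_pi fun a => (continuous_apply g).comp (continuous_apply a)
  have hUmem : (fun a g => condProb (P g) T a) ∈ U := by
    intro g w
    rw [leafProb_condProb (hac g) (hH g)]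
    refine mul_lt_of_lt_one_left (measureReal_leafBox_pos (hH g) T w) ?_
    rw [Real.exp_lt_one_iff]
    linarith
  have hU := thetaLaw_pos_of_mem_nhds hv₀ (hUo.mem_nhds hUmem)
  have hU' : 0 < (M.thetaLaw T v₀).real U := ENNReal.toReal_pos hU.ne' (measure_ne_top _ _)
  have hS : M.stateProb T v₀ ≤ ∑ v, M.stateProb T v :=
    Finset.single_le_sum (fun v _ => stateProb_nonneg T v) (Finset.mem_univ v₀)
  -- The upper constant only has to be positive and finite, so the total state probability need not
  -- be evaluated.
  refine ⟨M.stateProb T v₀ * (M.thetaLaw T v₀).real U, ∑ v, M.stateProb T v,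
    mul_pos hpos hU', hpos.trans_le hS, ?_⟩
  filter_upwards [hx.eventually_treeLik_le hP hH hlim T hε] with n hle
  have hint : ∀ v, Integrable (treeLik (m := N n) (fun g i => x g i) T) (M.thetaLaw T v) := by
    intro v
    refine Integrable.of_bound ((measurable_treeLik T).comp
      measurable_prodMk_left).aestronglyMeasurable
      (trueLik P (m := N n) (fun g i => x g i) T * Real.exp (ε * n))
      ((ae_thetaLaw_mem_Icc T v).mono fun θ hθ => ?_)
    rw [Real.norm_of_nonneg (treeLik_nonneg _ T hθ)]
    exact hle θ hθ
  constructor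
  · refine le_trans ?_ (Finset.single_le_sum (f := fun v => M.stateProb T v *
      ∫ θ, treeLik (m := N n) (fun g i => x g i) T θ ∂M.thetaLaw T v) (fun v _ =>
        mul_nonneg (stateProb_nonneg T v) (integral_treeLik_nonneg _ T v)) (Finset.mem_univ v₀))
    rw [mul_assoc, mul_assoc]
    refine mul_le_mul_of_nonneg_left ?_ hpos.le
    rw [← smul_eq_mul, ← integral_indicator_const _ hUo.measurableSet]
    refine integral_mono_ae ((integrable_const _).indicator hUo.measurableSet) (hint v₀)
      ((ae_thetaLaw_mem_Icc T v₀).mono fun θ hθ => ?_)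
    refine Set.indicator_apply_le' (fun hθU => ?_) fun _ => treeLik_nonneg _ T hθ
    have := le_treeLik hP hH (y := fun (g : Fin G) (i : Fin (N n g)) => x g i)
      (fun g i => hx.mem g i) T (θ := θ) (ε := ε) fun g w => (hθU g w).le
    rwa [hN n] at this
  · rw [marginalLik_eq, mul_assoc, Finset.sum_mul]
    refine Finset.sum_le_sum fun v _ => mul_le_mul_of_nonneg_left ?_ (stateProb_nonneg T v)
    refine (integral_mono_ae (hint v) (integrable_const _)
      ((ae_thetaLaw_mem_Icc T v).mono fun θ hθ => hle θ hθ)).trans_eq ?_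
    simp

end Likelihood

/-! ### The limiting criterion -/

section Criterion

variable {d G I K NL : ℕ}

theorem measurable_logApprox (H : Measure (Fin d → ℝ)) (T : Tree d K NL) :
    Measurable (logApprox H T) :=
  Finset.measurable_fun_sum _ fun _ _ =>
    measurable_const.indicator (BoxIntegral.Box.measurableSet_coe _)

theorem integrable_logApprox (H : Measure (Fin d → ℝ)) [IsFiniteMeasure H] (T : Tree d K NL) :
    Integrable (logApprox H T) H :=
  integrable_finsetSum _ fun _ _ =>
    (integrable_const _).indicator (BoxIntegral.Box.measurableSet_coe _)

theorem integral_logApprox (H : Measure (Fin d → ℝ)) [IsFiniteMeasure H] (T : Tree d K NL) :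
    ∫ z, logApprox H T z ∂H = approxEntropy H T := by
  simp only [logApprox]
  rw [integral_finsetSum _ fun w _ =>
    (integrable_const _).indicator (BoxIntegral.Box.measurableSet_coe _)]
  refine Finset.sum_congr rfl fun w _ => ?_
  rw [integral_indicator_const _ (BoxIntegral.Box.measurableSet_coe _), smul_eq_mul]

/-! ### Kullback-Leibler divergence from the tree approximation -/

variable {H : Measure (Fin d → ℝ)} [IsProbabilityMeasure H]

theorem treeApprox_eq_withDensity (hH : leb d ≪ H) (T : Tree d K NL) :
    treeApprox H T = (leb d).withDensity fun z => ENNReal.ofReal (Real.exp (logApprox H T z)) := by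
  ext s hs
  have hm : ∀ w : Leaf K, MeasurableSet (leafBox T w : Set (Fin d → ℝ)) := fun w =>
    BoxIntegral.Box.measurableSet_coe _
  rw [withDensity_apply _ hs, setLIntegral_congr_fun_ae (g := fun z => ∑ w : Leaf K,
    (leafBox T w : Set (Fin d → ℝ)).indicator (fun _ => H (leafBox T w) / leb d (leafBox T w)) z)
    hs]
  · rw [lintegral_finsetSum _ fun w _ => measurable_const.indicator (hm w), treeApprox,
      Measure.finsetSum_apply]
    refine Finset.sum_congr rfl fun w _ => ?_
    rw [lintegral_indicator_const (hm w), Measure.smul_apply, smul_eq_mul,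
      Measure.restrict_apply hs, Measure.restrict_apply (hm w), Set.inter_comm]
  · filter_upwards [ae_mem_Omega (d := d) Measure.AbsolutelyContinuous.rfl] with z hz _
    rw [exp_logApprox hH T hz, ENNReal.ofReal_sum_of_nonneg fun w _ =>
      Set.indicator_nonneg (fun _ _ => div_nonneg measureReal_nonneg measureReal_nonneg) _]
    refine Finset.sum_congr rfl fun w _ => ?_
    have hw : 0 < (leb d).real (leafBox T w) := leb_real_cell_pos T le_rfl w
    by_cases hz : z ∈ (leafBox T w : Set (Fin d → ℝ))
    · rw [Set.indicator_of_mem hz, Set.indicator_of_mem hz, ENNReal.ofReal_div_of_pos hw,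
        ofReal_measureReal, ofReal_measureReal]
    · rw [Set.indicator_of_notMem hz, Set.indicator_of_notMem hz, ENNReal.ofReal_zero]

/-- Equal total masses remove the mass correction in `klDiv`. -/
theorem treeApprox_univ (hac : H ≪ leb d) (T : Tree d K NL) :
    treeApprox H T Set.univ = 1 := by
  rw [treeApprox, Measure.finsetSum_apply, ← ENNReal.ofReal_one,
    ← sum_measureReal_cell hac T (le_refl K),
    ENNReal.ofReal_sum_of_nonneg fun _ _ => measureReal_nonneg]
  refine Finset.sum_congr rfl fun w _ => ?_
  have hw : 0 < (leb d).real (leafBox T w) := leb_real_cell_pos T le_rfl w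
  rw [Measure.smul_apply, Measure.restrict_apply_univ, smul_eq_mul, ENNReal.div_mul_cancel,
    ofReal_measureReal, leafBox]
  · exact fun h => by simp [measureReal_def, h] at hw
  · exact measure_ne_top _ _

theorem absolutelyContinuous_treeApprox (hac : H ≪ leb d) (hH : leb d ≪ H) (T : Tree d K NL) :
    H ≪ treeApprox H T := by
  rw [treeApprox_eq_withDensity hH]
  refine hac.trans (withDensity_absolutelyContinuous' ?_ ?_)
  · exact (measurable_logApprox H T).exp.ennreal_ofReal.aemeasurable
  · exact Eventually.of_forall fun z => (ENNReal.ofReal_pos.2 (Real.exp_pos _)).ne'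

/-- Chain rule for densities: `H|_T` has the density `exp (logApprox H T)` with respect to `leb d`.
-/
theorem llr_treeApprox (hac : H ≪ leb d) (hH : leb d ≪ H) (T : Tree d K NL) :
    llr H (treeApprox H T) =ᵐ[H] fun z => llr H (leb d) z - logApprox H T z := by
  have h1 := Measure.rnDeriv_withDensity_right_of_absolutelyContinuous hac
    (f := fun z => ENNReal.ofReal (Real.exp (logApprox H T z)))
    (measurable_logApprox H T).exp.ennreal_ofReal.aemeasurable
    (Eventually.of_forall fun z => (ENNReal.ofReal_pos.2 (Real.exp_pos _)).ne')
    (Eventually.of_forall fun z => ENNReal.ofReal_ne_top)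
  rw [← treeApprox_eq_withDensity hH] at h1
  filter_upwards [hac.ae_le h1, Measure.rnDeriv_pos hac,
    hac.ae_le (Measure.rnDeriv_lt_top H (leb d))] with z hz hpos htop
  have h2 : (H.rnDeriv (leb d) z).toReal ≠ 0 := (ENNReal.toReal_pos hpos.ne' htop.ne).ne'
  rw [llr, llr, hz, ENNReal.toReal_mul, ENNReal.toReal_inv,
    ENNReal.toReal_ofReal (Real.exp_pos _).le,
    Real.log_mul (inv_ne_zero (Real.exp_pos _).ne') h2, Real.log_inv, Real.log_exp]
  ring

/-- Integrates the chain rule against `H`. The nonnegativity is recorded because `ENNReal.ofReal` is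
additive only on nonnegative terms. -/
theorem klDiv_treeApprox (hac : H ≪ leb d) (hH : leb d ≪ H) (T : Tree d K NL)
    (hint : Integrable (llr H (leb d)) H) :
    0 ≤ ∫ z, llr H (leb d) z ∂H - approxEntropy H T ∧
    InformationTheory.klDiv H (treeApprox H T) =
      ENNReal.ofReal (∫ z, llr H (leb d) z ∂H - approxEntropy H T) := by
  have hllr := llr_treeApprox hac hH T
  have hi : Integrable (llr H (treeApprox H T)) H :=
    (hint.sub (integrable_logApprox H T)).congr hllr.symm
  have : IsProbabilityMeasure (treeApprox H T) := ⟨treeApprox_univ hac T⟩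
  have hAC := absolutelyContinuous_treeApprox hac hH T
  have hint' : ∫ z, llr H (treeApprox H T) z ∂H =
      ∫ z, llr H (leb d) z ∂H - approxEntropy H T := by
    rw [integral_congr_ae hllr, integral_sub hint (integrable_logApprox H T), integral_logApprox]
  have h1 := InformationTheory.klDiv_of_ac_of_integrable hAC hi
  have h2 := InformationTheory.integral_llr_add_sub_measure_univ_nonneg hAC hi
  rw [hint'] at h1 h2
  simp only [probReal_univ, add_sub_cancel_right] at h1 h2
  exact ⟨h2, h1⟩

/-- The two log-likelihood ratios differ by the integrable `logApprox H T`, so an infinite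
divergence from `leb d` is infinite for every tree. -/
theorem klDiv_treeApprox_eq_top (hac : H ≪ leb d) (hH : leb d ≪ H) (T : Tree d K NL)
    (hint : ¬Integrable (llr H (leb d)) H) :
    InformationTheory.klDiv H (treeApprox H T) = ∞ := by
  refine InformationTheory.klDiv_of_not_integrable fun hi => hint ?_
  refine (hi.add (integrable_logApprox H T)).congr ?_
  filter_upwards [llr_treeApprox hac hH T] with z hz
  rw [Pi.add_apply, hz, sub_add_cancel]

variable {M : Model d G I K NL} {P : Fin G → Measure (Fin d → ℝ)} {ζ : Fin G → ℝ}

theorem imbalance_nonneg (H : Measure (Fin d → ℝ)) (T : Tree d K NL) : 0 ≤ M.imbalance H T := by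
  refine Finset.sum_nonneg fun a _ => mul_nonneg measureReal_nonneg ?_
  rw [← M.f_zero]
  exact M.f_mono Set.self_mem_Ici (Set.mem_Ici.2 (abs_nonneg _)) (abs_nonneg _)

/-- A strict inequality between values of the criterion gives a strict inequality between the
exponential rates of the posterior weights, up to a constant. -/
theorem rate_lt_rate_of_criterion_lt (hP : ∀ g, IsProbabilityMeasure (P g))
    (hac : ∀ g, P g ≪ leb d) (hH : ∀ g, leb d ≪ P g) (hζ : ∀ g, 0 < ζ g) {T T' : Tree d K NL}
    (h : M.criterion P ζ T' < M.criterion P ζ T) :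
    -(∑ g, ζ g * (M.eta * M.imbalance (P g) T)) + ∑ g, ζ g * approxEntropy (P g) T <
      -(∑ g, ζ g * (M.eta * M.imbalance (P g) T')) + ∑ g, ζ g * approxEntropy (P g) T' := by
  -- Otherwise the criterion is infinite at `T'` too, contradicting the strict inequality; `ζ g > 0`
  -- excludes `0 * ∞`.
  have hint : ∀ g, Integrable (llr (P g) (leb d)) (P g) := by
    by_contra! hcon
    obtain ⟨g, hg⟩ := hcon
    refine not_top_lt (lt_of_le_of_lt (ge_of_eq ?_) h)
    refine ENNReal.sum_eq_top.2 ⟨g, Finset.mem_univ g, ?_⟩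
    rw [klDiv_treeApprox_eq_top (hac g) (hH g) T' hg, top_add, ENNReal.mul_top]
    exact (ENNReal.ofReal_pos.2 (hζ g)).ne'
  have hB : ∀ g T, 0 ≤ M.eta * M.imbalance (P g) T := fun g T =>
    mul_nonneg M.eta_nonneg (imbalance_nonneg _ T)
  have hkl := fun g T => klDiv_treeApprox (NL := NL) (K := K) (hac g) (hH g) T (hint g)
  have hcrit : ∀ T, M.criterion P ζ T = ENNReal.ofReal (∑ g, ζ g *
      (∫ z, llr (P g) (leb d) z ∂P g - approxEntropy (P g) T +
        M.eta * M.imbalance (P g) T)) := by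
    intro T
    rw [Model.criterion, ENNReal.ofReal_sum_of_nonneg fun g _ =>
      mul_nonneg (hζ g).le (add_nonneg (hkl g T).1 (hB g T))]
    refine Finset.sum_congr rfl fun g _ => ?_
    rw [(hkl g T).2, ENNReal.ofReal_mul (hζ g).le, ENNReal.ofReal_add (hkl g T).1 (hB g T)]
  rw [hcrit, hcrit] at h
  have h' := lt_of_not_ge fun hle => h.not_ge (ENNReal.ofReal_le_ofReal hle)
  -- The terms `∫ llr (P g) (leb d)` are common to both trees and cancel.
  simp only [mul_add, mul_sub, Finset.sum_add_distrib, Finset.sum_sub_distrib] at h'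
  linarith

end Criterion

/-! ### Consistency -/

section Consistency

variable {d G I K NL : ℕ} {M : Model d G I K NL} {P : Fin G → Measure (Fin d → ℝ)}
  {ζ : Fin G → ℝ} {N : ℕ → Fin G → ℕ}

theorem treePrior_nonneg {m : Fin G → ℕ} (y : Data d m) (T : Tree d K NL) :
    0 ≤ M.treePrior y T :=
  Finset.prod_nonneg fun _ _ => mul_nonneg (M.lam_pos _ _ _).le
    (div_nonneg (locWeight_pos _ _ _).le (Finset.sum_nonneg fun _ _ => (locWeight_pos _ _ _).le))

theorem IsTypical.tendsto_posterior {x : Fin G → ℕ → (Fin d → ℝ)} (hx : IsTypical K NL P ζ N x)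
    (hd : 0 < d) (hNL : 2 ≤ NL)
    (hP : ∀ g, IsProbabilityMeasure (P g)) (hac : ∀ g, P g ≪ leb d) (hH : ∀ g, leb d ≪ P g)
    (hN : ∀ n, ∑ g, N n g = n) (hζ : ∀ g, 0 < ζ g)
    (hlim : ∀ g, Tendsto (fun n : ℕ => (N n g : ℝ) / (n : ℝ)) atTop (𝓝 (ζ g)))
    (hfeas : ∀ T : Tree d K NL, 0 < M.feasibleProb P T) :
    Tendsto (fun n => M.posterior (m := N n) (fun g i => x g i) (M.minimisers P ζ)) atTop
      (𝓝 1) := by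
  classical
  have : Nonempty (Fin (NL - 1)) := ⟨⟨0, by omega⟩⟩
  have : Nonempty (Fin d) := ⟨⟨0, hd⟩⟩
  obtain ⟨l₀, hl₀⟩ := Finite.exists_min fun l : Fin (NL - 1) => M.f |loc l - 1 / 2|
  refine tendsto_sum_filter_div_sum
    (fun T => (hx.hasRate_treePrior hP hac hl₀ T).mul
      (hx.hasRate_marginalLik hP hac hH hN hlim T (hfeas T)))
    (fun T n => mul_nonneg (treePrior_nonneg _ T) (marginalLik_nonneg _ T)) _ fun T hT => ?_
  simp only [Model.minimisers, Set.mem_ofPred_eq, not_forall, not_le] at hT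
  obtain ⟨T', hT'⟩ := hT
  refine ⟨T', ?_⟩
  linarith [rate_lt_rate_of_criterion_lt hP hac hH hζ hT']

/-! ### Measurability of the posterior in the data -/

theorem measurable_count {m : Fin G → ℕ} {A : Set (Fin d → ℝ)} (hA : MeasurableSet A) :
    Measurable fun y : Data d m => count y A :=
  Finset.measurable_fun_sum _ fun g _ => Finset.measurable_fun_sum _ fun i _ =>
    (measurable_const.indicator hA).comp ((measurable_pi_apply i).comp (measurable_pi_apply g))

theorem measurable_treePrior {m : Fin G → ℕ} (T : Tree d K NL) :
    Measurable fun y : Data d m => M.treePrior y T := by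
  have h : ∀ A l, Measurable fun y : Data d m => M.locWeight y A l := fun A l =>
    (((measurable_count A.measurableSet_coe).const_mul _).mul_const _).neg.exp
  exact Finset.measurable_fun_prod _ fun a _ =>
    ((h _ _).div (Finset.measurable_fun_sum _ fun l _ => h _ l)).const_mul _

theorem measurable_marginalLik {m : Fin G → ℕ} (T : Tree d K NL) :
    Measurable fun y : Data d m => M.marginalLik y T :=
  Finset.measurable_fun_sum _ fun v _ => Measurable.const_mul
    (StronglyMeasurable.integral_prod_right (ν := M.thetaLaw T v)
      (f := fun (y : Data d m) θ => treeLik y T θ)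
      (measurable_treeLik T).stronglyMeasurable).measurable _

theorem measurable_posterior {m : Fin G → ℕ} (s : Set (Tree d K NL)) :
    Measurable fun y : Data d m => M.posterior y s := by
  have h : ∀ T, Measurable fun y : Data d m => M.treePrior y T * M.marginalLik y T :=
    fun T => (measurable_treePrior T).mul (measurable_marginalLik T)
  exact (Finset.measurable_fun_sum _ fun T _ => h T).div
    (Finset.measurable_fun_sum _ fun T _ => h T)

/-! ### Almost sure typicality of the samples -/

variable {S : Type*} [MeasurableSpace S] {μ : Measure S} [IsProbabilityMeasure μ]

/-- The law of large numbers for the frequencies of a set along random sample sizes. -/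
theorem ae_tendsto_frequency {H : Measure (Fin d → ℝ)} [IsProbabilityMeasure H]
    {X : ℕ → S → (Fin d → ℝ)} (hlaw : ∀ i, HasLaw (X i) H μ)
    (hindep : Pairwise fun i j => X i ⟂ᵢ[μ] X j) {k : ℕ → ℕ} {c : ℝ} (hc : 0 < c)
    (hk : Tendsto (fun n : ℕ => (k n : ℝ) / n) atTop (𝓝 c)) {A : Set (Fin d → ℝ)}
    (hA : MeasurableSet A) :
    ∀ᵐ ω ∂μ, Tendsto (fun n : ℕ =>
      (∑ i : Fin (k n), A.indicator (fun _ => (1 : ℝ)) (X i ω)) / n) atTop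
        (𝓝 (c * H.real A)) := by
  have hm : Measurable (A.indicator fun _ => (1 : ℝ)) := measurable_const.indicator hA
  -- A positive limiting proportion forces the group size to infinity, so the strong law applies
  -- along the subsequence of sizes `k n`.
  have hkt : Tendsto k atTop atTop := by
    rw [← tendsto_natCast_atTop_iff (R := ℝ)]
    refine (hk.pos_mul_atTop hc tendsto_natCast_atTop_atTop).congr' ?_
    filter_upwards [eventually_gt_atTop 0] with n hn
    have : (n : ℝ) ≠ 0 := by exact_mod_cast hn.ne'
    exact div_mul_cancel₀ _ this
  have hi : Integrable (fun ω => A.indicator (fun _ => (1 : ℝ)) (X 0 ω)) μ := by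
    refine Integrable.of_bound (hm.comp_aemeasurable (hlaw 0).aemeasurable).aestronglyMeasurable
      1 (Eventually.of_forall fun ω => ?_)
    exact (norm_indicator_le_norm_self _ _).trans (by simp)
  have hslln := strong_law_ae_real (μ := μ)
    (fun i ω => A.indicator (fun _ => (1 : ℝ)) (X i ω)) hi
    (fun i j hij => (hindep hij).comp hm hm)
    (fun i => ((hlaw i).identDistrib (hlaw 0)).comp hm)
  have hint : ∫ ω, A.indicator (fun _ => (1 : ℝ)) (X 0 ω) ∂μ = H.real A := by
    have := (hlaw 0).integral_comp (f := A.indicator fun _ => (1 : ℝ)) hm.aestronglyMeasurable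
    simp only [Function.comp_def] at this
    rw [this, integral_indicator_const _ hA]
    simp
  filter_upwards [hslln] with ω hω
  rw [hint] at hω
  refine (hk.mul (hω.comp hkt)).congr' ?_
  filter_upwards [hkt.eventually_gt_atTop 0] with n hn
  have : (k n : ℝ) ≠ 0 := by exact_mod_cast hn.ne'
  rw [Function.comp_apply, Finset.sum_range]
  field_simp

/-- Only countably many events are intersected: one for each observation and one for each group and
cell of a tree. -/
theorem ae_isTypical (hP : ∀ g, IsProbabilityMeasure (P g)) (hac : ∀ g, P g ≪ leb d)
    (hζ : ∀ g, 0 < ζ g)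
    (hlim : ∀ g, Tendsto (fun n : ℕ => (N n g : ℝ) / (n : ℝ)) atTop (𝓝 (ζ g)))
    {X : Fin G → ℕ → S → (Fin d → ℝ)} (hlaw : ∀ g i, HasLaw (X g i) (P g) μ)
    (hindep : iIndepFun (fun p : Fin G × ℕ => X p.1 p.2) μ) :
    ∀ᵐ ω ∂μ, IsTypical K NL P ζ N fun g i => X g i ω := by
  have h1 : ∀ᵐ ω ∂μ, ∀ g i, X g i ω ∈ Omega d := by
    refine ae_all_iff.2 fun g => ae_all_iff.2 fun i => ?_
    refine ae_of_ae_map (hlaw g i).aemeasurable ?_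
    rw [(hlaw g i).map_eq]
    exact ae_mem_Omega (hac g)
  have h2 : ∀ᵐ ω ∂μ, ∀ g (T : Tree d K NL) (k : ℕ) (h : k ≤ K) (w : Fin k → Bool),
      Tendsto (fun n : ℕ => (∑ i : Fin (N n g),
        (cell T k h w : Set (Fin d → ℝ)).indicator (fun _ => (1 : ℝ)) (X g i ω)) / n) atTop
        (𝓝 (ζ g * (P g).real (cell T k h w))) := by
    refine ae_all_iff.2 fun g => ae_all_iff.2 fun T => ae_all_iff.2 fun k =>
      ae_all_iff.2 fun h => ae_all_iff.2 fun w => ?_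
    refine ae_tendsto_frequency (hlaw g) (fun i j hij => ?_) (hζ g) (hlim g)
      (BoxIntegral.Box.measurableSet_coe _)
    exact hindep.indepFun (i := (g, i)) (j := (g, j)) (by simpa using hij)
  filter_upwards [h1, h2] with ω h1 h2 using ⟨h1, h2⟩

end Consistency

end PolyaTree

end

theorem theorem1 {d G I K NL : ℕ} (hd : 0 < d) (hNL : 2 ≤ NL)
    (M : PolyaTree.Model d G I K NL)
    (P : Fin G → Measure (Fin d → ℝ)) (hP : ∀ g, IsProbabilityMeasure (P g))
    (hac : ∀ g, P g ≪ PolyaTree.leb d)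
    (hpos : ∀ g, ∀ᵐ z ∂(PolyaTree.leb d), 0 < (P g).rnDeriv (PolyaTree.leb d) z)
    (N : ℕ → Fin G → ℕ) (hN : ∀ n, ∑ g, N n g = n)
    (ζ : Fin G → ℝ) (hζ : ∀ g, 0 < ζ g)
    (hlim : ∀ g, Tendsto (fun n : ℕ => (N n g : ℝ) / (n : ℝ)) atTop (𝓝 (ζ g)))
    (hfeas : ∀ T : PolyaTree.Tree d K NL, 0 < M.feasibleProb P T)
    {S : Type*} [MeasurableSpace S] (μ : Measure S) [IsProbabilityMeasure μ]
    (X : Fin G → ℕ → S → (Fin d → ℝ)) (hlaw : ∀ g i, HasLaw (X g i) (P g) μ)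
    (hindep : iIndepFun (fun p : Fin G × ℕ => X p.1 p.2) μ) :
    TendstoInMeasure μ
      (fun n ω => M.posterior (m := N n) (fun g i => X g i ω) (M.minimisers P ζ))
      atTop (fun _ => (1 : ℝ)) := by
  have hH : ∀ g, PolyaTree.leb d ≪ P g := fun g =>
    PolyaTree.leb_absolutelyContinuous (hac g) (hpos g)
  -- The convergence even holds almost surely, which on a probability space is stronger for
  -- measurable sequences.
  refine tendstoInMeasure_of_tendsto_ae (fun n => ?_) ?_
  · refine ((PolyaTree.measurable_posterior _).comp_aemeasurable ?_).aestronglyMeasurable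
    exact aemeasurable_pi_lambda _ fun g => aemeasurable_pi_lambda _ fun i =>
      (hlaw g i).aemeasurable
  · filter_upwards [PolyaTree.ae_isTypical (K := K) (NL := NL) hP hac hζ hlim hlaw hindep]
      with ω hω
    exact hω.tendsto_posterior hd hNL hP hac hH hN hζ hlim hfeas
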